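/- Let $X_1,X_2,\dots$ be independent observations with values in a measurable space, whose joint distribution $P_\theta$ depends on $\theta\in\Theta$, $\Theta\subset\mathbb R$ open, and let $\theta_0\in\Theta$. Under $\theta\in\Theta$ let $X_j$ have density $f_{\theta,j}$ with respect to a $\sigma$-finite measure $\mu$; put $f^n_{\theta_0}(x_1,\dots,x_n)=\prod_{i=1}^n f_{\theta_0,i}(x_i)$ and let $\mu^n$ be the $n$-fold product of $\mu$. A sequential test is a pair $(\psi,\phi)$ of a stopping rule $\psi=(\psi_n)_{n\ge1}$ and a decision rule $\phi=(\phi_n)_{n\ge1}$, where $\psi_n,\phi_n$ are measurable functions of $(x_1,\dots,x_n)$ with values in $[0,1]$. Put $t_n^\psi=(1-\psi_1)\cdots(1-\psi_{n-1})$ (with $t_1^\psi=1$) and $s_n^\psi=t_n^\psi\psi_n$. The stopping time $\tau_\psi$ has $P_\theta(\tau_\psi=n)=E_\theta s_n^\psi$; the average sample number (ASN) $E_\theta\tau_\psi$ is $\sum_{n\ge1}nP_\theta(\tau_\psi=n)$ if $\sum_{n\ge1} P_\theta(\tau_\psi=n)=1$ and $\infty$ otherwise. The power function is $\beta_\theta(\psi,\phi)=\sum_{n\ge1}E_\theta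 s_n^\psi\phi_n$, the type-I error probability is $\alpha(\psi,\phi)=\beta_{\theta_0}(\psi,\phi)$, and $\dot\beta_{\theta_0}(\psi,\phi)$ is the derivative of $\theta\mapsto\beta_\theta(\psi,\phi)$ at $\theta_0$. Assume: 1. There are $\delta>0$ and $0<\gamma_1<\infty$ such that the Kullback–Leibler informations satisfy $E_{\theta_0}\ln\frac{f_{\theta_0,j}(X_j)}{f_{\theta,j}(X_j)}\le\gamma_1(\theta-\theta_0)^2$ for all $j\ge1$ and all $\theta\in\Theta$ with $|\theta-\theta_0|\le\delta$. 2. For every $j\ge1$ there is a $\mu$-integrable function $\dot f_{\theta_0,j}$ with $\int|f_{\theta,j}-f_{\theta_0,j}-(\theta-\theta_0)\dot f_{\theta_0,j}|\,d\mu=o(\theta-\theta_0)$ as $\theta\to\theta_0$. 3. With $q_j=\dot f_{\theta_0,j}/f_{\theta_0,j}$, there is $0<\gamma_2<\infty$ such that $E_{\theta_0}|q_j(X_j)|\le\gamma_2$ for all $j\ge1$. Let $z_n=\sum_{i=1}^nq_i(x_i)$ where $f^n_{\theta_0}>0$, and $z_n=0$ where $f^n_{\theta_0}=0$. Let $b>0$,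 $c>0$ and $g(z)=\min\{0,z\}$. For $N\ge1$ let $v_N^N=g$ and, for $n=N,\dots,1$, $r_{n-1}^N(z;c)=E_{\theta_0}v_n^N(z-q_n(X_n);c)$ and $v_{n-1}^N(z;c)=\min\{g(z),\,c+r_{n-1}^N(z;c)\}$; let $r_n(z;c)=\lim_{N\to\infty}r_n^N(z;c)$. Let $\psi$ be a stopping rule such that $$I_{\{g(b-z_n)<c+r_n(b-z_n;c)\}}\le\psi_n\le I_{\{g(b-z_n)\le c+r_n(b-z_n;c)\}}\qquad(\mathrm S)$$ $\mu^n$-almost everywhere on $\{t_n^\psi>0\}\cap\{f_{\theta_0}^n>0\}$ for all $n\ge1$, and let $\phi$ be a decision rule such that $$I_{\{z_n>b\}}\le\phi_n\le I_{\{z_n\ge b\}}\qquad(\mathrm D)$$ $\mu^n$-almost everywhere on $\{s_n^\psi>0\}\cap\{f_{\theta_0}^n>0\}$ for all $n\ge1$. Suppose that $E_{\theta_0}\tau_\psi<\infty$. Then the power function of every test with finite ASN at $\theta_0$ is differentiable at $\theta_0$, and for every test $(\psi',\phi')$ with $E_{\theta_0}\tau_{\psi'}<\infty$, $\alpha(\psi',\phi')\le\alpha(\psi,\phi)$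 and $E_{\theta_0}\tau_{\psi'}\le E_{\theta_0}\tau_\psi$, $$\dot\beta_{\theta_0}(\psi,\phi)\ge\dot\beta_{\theta_0}(\psi',\phi').$$ This inequality is strict if at least one of the two constraints holds with strict inequality. If all three hold with equality, then $\psi'$ satisfies (S) $\mu^n$-almost everywhere on $\{t_n^{\psi'}>0\}\cap\{f_{\theta_0}^n>0\}$ for all $n\ge1$ (with $\psi'_n$ in place of $\psi_n$), and $\phi'$ satisfies (D) $\mu^n$-almost everywhere on $\{s_n^{\psi'}>0\}\cap\{f_{\theta_0}^n>0\}$ for all $n\ge1$ (with $\phi'_n$ in place of $\phi_n$). -/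

import Mathlib

open MeasureTheory ProbabilityTheory Filter Topology Asymptotics
open scoped ENNReal

namespace SeqTest

/-- The statistical model: a process `X₁, X₂, …` of independent observations in `𝓧`, whose
distribution depends on `θ ∈ Θ`, `Θ` open in `ℝ`, with a distinguished `θ₀ ∈ Θ`. Under `θ ∈ Θ`
each observation has a density with respect to one σ-finite measure `μ`.
Observations are numbered from `0` here: `X j`, `f θ j` are the `(j+1)`-th observation and its
density. Nothing is required for `θ ∉ Θ`. -/
structure Model (𝓧 Ω : Type*) [MeasurableSpace 𝓧] [MeasurableSpace Ω] where
  /-- the parameter set -/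
  Θ : Set ℝ
  isOpen_Θ : IsOpen Θ
  /-- the null hypothesis -/
  θ₀ : ℝ
  θ₀_mem : θ₀ ∈ Θ
  /-- the probability measures `P_θ` -/
  P : ℝ → Measure Ω
  isProbabilityMeasure_P : ∀ θ ∈ Θ, IsProbabilityMeasure (P θ)
  /-- the observations -/
  X : ℕ → Ω → 𝓧
  measurable_X : ∀ j, Measurable (X j)
  iIndepFun_X : ∀ θ ∈ Θ, iIndepFun X (P θ)
  /-- the dominating measure -/
  μ : Measure 𝓧
  sigmaFinite_μ : SigmaFinite μ
  /-- the densities -/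
  f : ℝ → ℕ → 𝓧 → ℝ
  measurable_f : ∀ θ ∈ Θ, ∀ j, Measurable (f θ j)
  f_nonneg : ∀ θ ∈ Θ, ∀ j x, 0 ≤ f θ j x
  map_X : ∀ θ ∈ Θ, ∀ j, (P θ).map (X j) = μ.withDensity fun x => ENNReal.ofReal (f θ j x)

/-- A randomized rule: measurable functions `ψ_n = ψ_n(x₁, …, x_n)` with values in `[0, 1]`.
Only `n ≥ 1` is ever used. Both stopping rules and decision rules are of this kind. -/
structure Rule (𝓧 : Type*) [MeasurableSpace 𝓧] where
  /-- the function of the first `n` observations -/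
  val : (n : ℕ) → (Fin n → 𝓧) → ℝ
  measurable_val : ∀ n, Measurable (val n)
  mem_Icc : ∀ n x, val n x ∈ Set.Icc (0 : ℝ) 1

section Rules

variable {𝓧 : Type*} [MeasurableSpace 𝓧]

/-- `t_n = (1 - ψ₁) ⋯ (1 - ψ_{n-1})`, for `n ≥ 1`, with `t₁ = 1`. -/
def t (ψ : Rule 𝓧) : (n : ℕ) → (Fin n → 𝓧) → ℝ
  | 0, _ => 1
  | 1, _ => 1
  | n + 2, x =>
      t ψ (n + 1) (fun i => x i.castSucc) * (1 - ψ.val (n + 1) (fun i => x i.castSucc))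

/-- `s_n = (1 - ψ₁) ⋯ (1 - ψ_{n-1}) ψ_n`, for `n ≥ 1`. -/
def s (ψ : Rule 𝓧) (n : ℕ) (x : Fin n → 𝓧) : ℝ := t ψ n x * ψ.val n x

end Rules

/-- `g(z) = min {0, z}`. -/
noncomputable def g (z : ℝ) : ℝ := min 0 z

namespace Model

variable {𝓧 Ω : Type*} [MeasurableSpace 𝓧] [MeasurableSpace Ω] (M : Model 𝓧 Ω)

/-- `E_θ F(X₁, …, X_n)`. -/
noncomputable def expect (θ : ℝ) (n : ℕ) (F : (Fin n → 𝓧) → ℝ) : ℝ :=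
  ∫ ω, F (fun i => M.X i ω) ∂(M.P θ)

/-- `P_θ(τ_ψ = n) = E_θ s_n`. -/
noncomputable def stopProb (θ : ℝ) (ψ : Rule 𝓧) (n : ℕ) : ℝ := M.expect θ n (s ψ n)

open scoped Classical in
/-- The average sample number: `∑_{n ≥ 1} n P_θ(τ_ψ = n)` if `P_θ(τ_ψ < ∞) = 1`, and `∞`
otherwise. -/
noncomputable def asn (θ : ℝ) (ψ : Rule 𝓧) : ℝ≥0∞ :=
  if ∑' n : ℕ, M.stopProb θ ψ (n + 1) = 1 then
    ∑' n : ℕ, ((n + 1 : ℕ) : ℝ≥0∞) * ENNReal.ofReal (M.stopProb θ ψ (n + 1))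
  else ⊤

/-- The power function `β_θ(ψ, φ) = ∑_{n ≥ 1} E_θ s_n φ_n` (a convergent series of nonnegative
terms for `θ ∈ Θ`). -/
noncomputable def power (ψ φ : Rule 𝓧) (θ : ℝ) : ℝ :=
  ∑' n : ℕ, M.expect θ (n + 1) (fun x => s ψ (n + 1) x * φ.val (n + 1) x)

/-- The type-I error probability. -/
noncomputable def alpha (ψ φ : Rule 𝓧) : ℝ := M.power ψ φ M.θ₀

/-- The null average sample number. -/
noncomputable def asn₀ (ψ : Rule 𝓧) : ℝ≥0∞ := M.asn M.θ₀ ψ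

/-- The derivative of the power function at `θ₀`. -/
noncomputable def powerDeriv (ψ φ : Rule 𝓧) : ℝ := deriv (M.power ψ φ) M.θ₀

/-- The Kullback–Leibler information of a single observation is at most `γ₁ (θ - θ₀)²`, uniformly
over the observations, for `θ` near `θ₀`. -/
def Assumption1 : Prop :=
  ∃ δ > (0 : ℝ), ∃ γ₁ > (0 : ℝ), ∀ j, ∀ θ ∈ M.Θ, |θ - M.θ₀| ≤ δ →
    InformationTheory.klDiv ((M.P M.θ₀).map (M.X j)) ((M.P θ).map (M.X j))
      ≤ ENNReal.ofReal (γ₁ * (θ - M.θ₀) ^ 2)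

/-- `fdot j` is the derivative at `θ₀` of `θ ↦ f θ j` in `L₁(μ)`, for every `j`. -/
def Assumption2 (fdot : ℕ → 𝓧 → ℝ) : Prop :=
  ∀ j, Integrable (fdot j) M.μ ∧
    (fun θ => ∫ x, |M.f θ j x - M.f M.θ₀ j x - (θ - M.θ₀) * fdot j x| ∂M.μ)
      =o[𝓝 M.θ₀] fun θ => θ - M.θ₀

/-- The score `q_j = fdot_j / f_{θ₀,j}`. -/
noncomputable def q (fdot : ℕ → 𝓧 → ℝ) (j : ℕ) (x : 𝓧) : ℝ := fdot j x / M.f M.θ₀ j x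

/-- The scores have uniformly bounded null expected absolute value. -/
def Assumption3 (fdot : ℕ → 𝓧 → ℝ) : Prop :=
  ∃ γ₂ > (0 : ℝ), ∀ j, ∫⁻ ω, ‖M.q fdot j (M.X j ω)‖ₑ ∂(M.P M.θ₀) ≤ ENNReal.ofReal γ₂

/-- The joint null density `f_{θ₀}^n` of the first `n` observations. -/
noncomputable def jointDensity₀ (n : ℕ) (x : Fin n → 𝓧) : ℝ := ∏ i : Fin n, M.f M.θ₀ i (x i)

open scoped Classical in
/-- The cumulative score `z_n = ∑_{i ≤ n} q_i(x_i)`, set to `0` where `f_{θ₀}^n` vanishes. -/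
noncomputable def z (fdot : ℕ → 𝓧 → ℝ) (n : ℕ) (x : Fin n → 𝓧) : ℝ :=
  if M.jointDensity₀ n x = 0 then 0 else ∑ i : Fin n, M.q fdot i (x i)

/-- Backward induction with `k` steps left, at stage `n`: `vAux c k n` is the function
`v_n^{n+k}(·; c)`. The next observation after stage `n` is `X n`. -/
noncomputable def vAux (fdot : ℕ → 𝓧 → ℝ) (c : ℝ) : (k n : ℕ) → ℝ → ℝ
  | 0, _, z => g z
  | k + 1, n, z =>
      min (g z) (c + ∫ ω, vAux fdot c k (n + 1) (z - M.q fdot n (M.X n ω)) ∂(M.P M.θ₀))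

/-- `v_n^N(z; c)`, for `n ≤ N`: `v_N^N = g` and
`v_{n-1}^N(z) = min {g(z), c + E_{θ₀} v_n^N(z - q_n)}`. -/
noncomputable def v (fdot : ℕ → 𝓧 → ℝ) (c : ℝ) (N n : ℕ) (z : ℝ) : ℝ :=
  M.vAux fdot c (N - n) n z

/-- `r_n^N(z; c) = E_{θ₀} v_{n+1}^N(z - q_{n+1}; c)`, for `n < N`. -/
noncomputable def rTrunc (fdot : ℕ → 𝓧 → ℝ) (c : ℝ) (N n : ℕ) (z : ℝ) : ℝ :=
  ∫ ω, M.v fdot c N (n + 1) (z - M.q fdot n (M.X n ω)) ∂(M.P M.θ₀)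

/-- `r_n(z; c) = lim_{N → ∞} r_n^N(z; c)`, finite or not. -/
noncomputable def r (fdot : ℕ → 𝓧 → ℝ) (c : ℝ) (n : ℕ) (z : ℝ) : EReal :=
  limUnder atTop fun N : ℕ => (M.rTrunc fdot c N n z : EReal)

open scoped Classical in
/-- The form of the stopping rule: `I{g(b - z_n) < c + r_n(b - z_n)} ≤ ψ_n ≤
I{g(b - z_n) ≤ c + r_n(b - z_n)}`, `μⁿ`-a.e. on `{t_n > 0} ∩ {f_{θ₀}^n > 0}`, `n ≥ 1`. -/
def StoppingForm (fdot : ℕ → 𝓧 → ℝ) (b c : ℝ) (ψ : Rule 𝓧) : Prop :=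
  ∀ n : ℕ, 1 ≤ n → ∀ᵐ x ∂(Measure.pi fun _ : Fin n => M.μ),
    0 < t ψ n x → 0 < M.jointDensity₀ n x →
      (if (g (b - M.z fdot n x) : EReal) < (c : EReal) + M.r fdot c n (b - M.z fdot n x)
        then (1 : ℝ) else 0) ≤ ψ.val n x ∧
      ψ.val n x ≤
        (if (g (b - M.z fdot n x) : EReal) ≤ (c : EReal) + M.r fdot c n (b - M.z fdot n x)
          then (1 : ℝ) else 0)

open scoped Classical in
/-- The form of the decision rule: `I{z_n > b} ≤ φ_n ≤ I{z_n ≥ b}`,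
`μⁿ`-a.e. on `{s_n > 0} ∩ {f_{θ₀}^n > 0}`, `n ≥ 1`. -/
def DecisionForm (fdot : ℕ → 𝓧 → ℝ) (b : ℝ) (ψ φ : Rule 𝓧) : Prop :=
  ∀ n : ℕ, 1 ≤ n → ∀ᵐ x ∂(Measure.pi fun _ : Fin n => M.μ),
    0 < s ψ n x → 0 < M.jointDensity₀ n x →
      (if b < M.z fdot n x then (1 : ℝ) else 0) ≤ φ.val n x ∧
      φ.val n x ≤ (if b ≤ M.z fdot n x then (1 : ℝ) else 0)

end Model

end SeqTest

/-! The numbers `b` and `c` are Lagrange multipliers: `b` prices the type-I error, `c` one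
observation. For a test with finite null ASN let L = c E τ + b α − β̇, everything at θ₀. Since β̇ is
the limit of the sums of E s_n φ_n z_n over n ≤ N, L is the expected value of c τ + φ_τ (b − z_τ).
Given stopping, the best decision turns the second term into g(b − z_τ), so minimizing L is an
optimal stopping problem, solved by backward induction. The first observation is compulsory, so the
minimum is c + r₀(b).

`IsOptimalValue.hasSum_lossGap` gives L − (c + r₀(b)) exactly, as a series of expected nonnegative
losses, one term per stage. By `Model.forms_iff` all of them vanish if and only if (S) and (D) hold.
So the given test minimizes L. As `b` and `c` are positive, the constraints on α and E τ turn this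
into the inequality between the derivatives, strict if a constraint is. Equality throughout forces
all losses of the competitor to vanish.

Three analytic facts support this. First, a Kullback–Leibler bound controls the Hellinger distance.
This gives a total variation bound of order |θ − θ₀| for each observation and, after passing to the
limit in difference quotients, E q_j² ≤ 4γ₁ (`Model.memLp_score`). Hence z_n is a centred random
walk of variance at most 4γ₁n, and E[|z_N|; τ > N] → 0 by Cauchy–Schwarz, because N P(τ > N) → 0.

Second, the power function is differentiable. Rejections up to stage N expand to first order, being
expectations over finite products. For later rejections, exchanging the laws of the first N
observations costs |θ − θ₀| E[|z_N|; τ > N] up to o(θ − θ₀), and exchanging the later laws costs a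
multiple of |θ − θ₀| ∑_{i ≥ N} P(τ > i). Both coefficients vanish as N → ∞
(`abs_tsum_rejProb_sub_le`, `exists_hasDerivAt_of_approx`).

Third, the limits r_n are finite: a smooth function below g that loses at most `c` in mean per step
lies below every truncated value (`minorant_le_truncValue`). -/

namespace SeqTest

/-! ### Laws of finite samples, built one observation at a time. -/

section ProductLaws

variable {𝓧 : Type*}

/-- Append one observation to a finite sample. -/
def push {n : ℕ} (x : Fin n → 𝓧) (y : 𝓧) : Fin (n + 1) → 𝓧 := Fin.snoc (α := fun _ => 𝓧) x y

@[simp] lemma push_castSucc {n : ℕ} (x : Fin n → 𝓧) (y : 𝓧) (i : Fin n) :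
    push x y i.castSucc = x i := by simp [push]

@[simp] lemma push_last {n : ℕ} (x : Fin n → 𝓧) (y : 𝓧) : push x y (Fin.last n) = y := by
  simp [push]

/-- Forget the last observation. -/
def pop {n : ℕ} (x : Fin (n + 1) → 𝓧) : Fin n → 𝓧 := fun i => x i.castSucc

@[simp] lemma pop_push {n : ℕ} (x : Fin n → 𝓧) (y : 𝓧) : pop (push x y) = x := by
  ext i; simp [pop]

variable [MeasurableSpace 𝓧]

lemma measurable_pop (n : ℕ) : Measurable (pop : (Fin (n + 1) → 𝓧) → Fin n → 𝓧) :=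
  measurable_pi_lambda _ fun i => measurable_pi_apply i.castSucc

lemma measurable_push (n : ℕ) :
    Measurable (fun p : (Fin n → 𝓧) × 𝓧 => push p.1 p.2) := by
  refine measurable_pi_lambda _ fun i => ?_
  induction i using Fin.lastCases with
  | last => simpa using measurable_snd
  | cast i =>
    simp only [push_castSucc]
    exact (measurable_pi_apply i).comp measurable_fst

lemma measurable_push_right {n : ℕ} (x : Fin n → 𝓧) : Measurable (push x) :=
  (measurable_push n).comp measurable_prodMk_left

/-- The joint law of the first `n` of a sequence of independent observations. -/
noncomputable def law (m : ℕ → Measure 𝓧) (n : ℕ) : Measure (Fin n → 𝓧) :=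
  Measure.pi fun i : Fin n => m i

instance (m : ℕ → Measure 𝓧) [∀ i, SigmaFinite (m i)] (n : ℕ) : SigmaFinite (law m n) := by
  unfold law; infer_instance

instance (m : ℕ → Measure 𝓧) [∀ i, IsProbabilityMeasure (m i)] (n : ℕ) :
    IsProbabilityMeasure (law m n) := by
  unfold law; infer_instance

/-- Basis for all later inductions on the sample size: Fubini lets the last observation be
integrated out first. -/
lemma measurePreserving_push (m : ℕ → Measure 𝓧) [∀ i, SigmaFinite (m i)] (n : ℕ) :
    MeasurePreserving (fun p : (Fin n → 𝓧) × 𝓧 => push p.1 p.2)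
      ((law m n).prod (m n)) (law m (n + 1)) := by
  refine ⟨measurable_push n, ?_⟩
  refine (Measure.pi_eq fun S hS => ?_).symm
  rw [Measure.map_apply (measurable_push n) (MeasurableSet.univ_pi hS)]
  have : (fun p : (Fin n → 𝓧) × 𝓧 => push p.1 p.2) ⁻¹' (Set.univ.pi S)
      = (Set.univ.pi fun i : Fin n => S i.castSucc) ×ˢ S (Fin.last n) := by
    ext p
    simp [Set.mem_pi, Fin.forall_fin_succ', push]
  rw [this, Measure.prod_prod, law, Measure.pi_pi, Fin.prod_univ_castSucc]
  simp

lemma integrable_push {m : ℕ → Measure 𝓧} [∀ i, SigmaFinite (m i)] {n : ℕ}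
    {G : (Fin (n + 1) → 𝓧) → ℝ} (hG : Integrable G (law m (n + 1))) :
    Integrable (fun p : (Fin n → 𝓧) × 𝓧 => G (push p.1 p.2)) ((law m n).prod (m n)) :=
  (measurePreserving_push m n).integrable_comp_of_integrable hG

lemma integral_law_succ {m : ℕ → Measure 𝓧} [∀ i, SigmaFinite (m i)] {n : ℕ}
    {G : (Fin (n + 1) → 𝓧) → ℝ} (hG : Integrable G (law m (n + 1))) :
    ∫ x, G x ∂law m (n + 1) = ∫ x, ∫ y, G (push x y) ∂m n ∂law m n := by
  rw [← integral_prod (fun p : (Fin n → 𝓧) × 𝓧 => G (push p.1 p.2)) (integrable_push hG),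
    ← (measurePreserving_push m n).map_eq]
  refine integral_map (measurable_push n).aemeasurable ?_
  rw [(measurePreserving_push m n).map_eq]
  exact hG.1

lemma measurePreserving_pop (m : ℕ → Measure 𝓧) [∀ i, IsProbabilityMeasure (m i)] (n : ℕ) :
    MeasurePreserving (pop : (Fin (n + 1) → 𝓧) → Fin n → 𝓧) (law m (n + 1)) (law m n) := by
  refine ⟨measurable_pop n, ?_⟩
  rw [← (measurePreserving_push m n).map_eq, Measure.map_map (measurable_pop n) (measurable_push n)]
  have : (pop ∘ fun p : (Fin n → 𝓧) × 𝓧 => push p.1 p.2) = Prod.fst := by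
    ext p : 1; simp
  rw [this]
  exact measurePreserving_fst.map_eq

lemma measurePreserving_eval_last (m : ℕ → Measure 𝓧) [∀ i, IsProbabilityMeasure (m i)] (n : ℕ) :
    MeasurePreserving (fun x : Fin (n + 1) → 𝓧 => x (Fin.last n)) (law m (n + 1)) (m n) := by
  refine ⟨measurable_pi_apply _, ?_⟩
  rw [← (measurePreserving_push m n).map_eq,
    Measure.map_map (measurable_pi_apply _) (measurable_push n)]
  have : ((fun x : Fin (n + 1) → 𝓧 => x (Fin.last n)) ∘
      fun p : (Fin n → 𝓧) × 𝓧 => push p.1 p.2) = Prod.snd := by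
    ext p : 1; simp
  rw [this]
  exact measurePreserving_snd.map_eq

lemma integral_pop (m : ℕ → Measure 𝓧) [∀ i, IsProbabilityMeasure (m i)] {n : ℕ}
    {G : (Fin n → 𝓧) → ℝ} (hG : AEStronglyMeasurable G (law m n)) :
    ∫ x, G (pop x) ∂law m (n + 1) = ∫ x, G x ∂law m n := by
  rw [← (measurePreserving_pop m n).map_eq] at hG ⊢
  exact (integral_map (measurable_pop n).aemeasurable hG).symm

lemma integral_law_zero (m : ℕ → Measure 𝓧) (G : (Fin 0 → 𝓧) → ℝ) :
    ∫ x, G x ∂law m 0 = G default := by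
  rw [law, Measure.pi_of_empty _ default]
  have : G = fun _ => G default := by ext x; rw [Subsingleton.elim x default]
  rw [this]
  simp

lemma law_withDensity (μ : Measure 𝓧) [SigmaFinite μ] {f : ℕ → 𝓧 → ℝ≥0∞}
    (hf : ∀ i, Measurable (f i)) [∀ i, SigmaFinite (μ.withDensity (f i))] (n : ℕ) :
    law (fun i => μ.withDensity (f i)) n
      = (Measure.pi fun _ : Fin n => μ).withDensity fun x => ∏ i : Fin n, f i (x i) := by
  induction n with
  | zero => simp [law, Measure.pi_of_empty _ (default : Fin 0 → 𝓧)]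
  | succ n ih =>
    have hF : Measurable fun x : Fin n → 𝓧 => ∏ i : Fin n, f i (x i) :=
      Finset.measurable_prod _ fun i _ => (hf i).comp (measurable_pi_apply i)
    have hF' : Measurable fun x : Fin (n + 1) → 𝓧 => ∏ i : Fin (n + 1), f i (x i) :=
      Finset.measurable_prod _ fun i _ => (hf i).comp (measurable_pi_apply i)
    have hμ := measurePreserving_push (fun _ => μ) n
    rw [← (measurePreserving_push _ n).map_eq]
    have hsf : SigmaFinite ((Measure.pi fun _ : Fin n => μ).withDensity
        fun x => ∏ i : Fin n, f i (x i)) := ih ▸ inferInstance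
    rw [ih, prod_withDensity hF (hf n)]
    ext S hS
    rw [Measure.map_apply (measurable_push n) hS, withDensity_apply _ (measurable_push n hS),
      withDensity_apply _ hS]
    change _ = ∫⁻ x in S, _ ∂law (fun _ => μ) (n + 1)
    rw [← hμ.map_eq, setLIntegral_map hS hF' (measurable_push n)]
    simp [Fin.prod_univ_castSucc, law]

end ProductLaws

/-! ### Cauchy–Schwarz, and Kullback–Leibler against Hellinger. -/

section Inequalities

variable {α : Type*} [MeasurableSpace α]

lemma sq_integral_mul_le {m : Measure α} {f g : α → ℝ} (hf : MemLp f 2 m) (hg : MemLp g 2 m) :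
    (∫ x, f x * g x ∂m) ^ 2 ≤ (∫ x, f x ^ 2 ∂m) * ∫ x, g x ^ 2 ∂m := by
  have hff := hf.integrable_sq
  have hgg := hg.integrable_sq
  have hfg : Integrable (fun x => f x * g x) m := hf.integrable_mul hg
  have key : ∀ t : ℝ, 0 ≤ (∫ x, f x ^ 2 ∂m) * (t * t) + (2 * ∫ x, f x * g x ∂m) * t
      + ∫ x, g x ^ 2 ∂m := by
    intro t
    have : (∫ x, f x ^ 2 ∂m) * (t * t) + (2 * ∫ x, f x * g x ∂m) * t + ∫ x, g x ^ 2 ∂m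
        = ∫ x, (t * f x + g x) ^ 2 ∂m := by
      have e : (fun x => (t * f x + g x) ^ 2)
          = fun x => (t * t * f x ^ 2 + 2 * t * (f x * g x)) + g x ^ 2 := by
        ext x; ring
      have h1 : Integrable (fun x => t * t * f x ^ 2) m := hff.const_mul _
      have h2 : Integrable (fun x => 2 * t * (f x * g x)) m := hfg.const_mul _
      have h12 : Integrable (fun x => t * t * f x ^ 2 + 2 * t * (f x * g x)) m := h1.add h2
      rw [e, integral_add h12 hgg, integral_add h1 h2, integral_const_mul, integral_const_mul]
      ring
    rw [this]
    exact integral_nonneg fun x => sq_nonneg _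
  have := discrim_le_zero key
  rw [discrim] at this
  nlinarith

/-- From log √p ≥ 1 − 1/√p one gets p log p ≥ 2p − 2√p. Integrated, this bounds the squared
Hellinger distance by the divergence. -/
lemma sq_sqrt_sub_one_le_klFun {p : ℝ} (hp : 0 ≤ p) :
    (√p - 1) ^ 2 ≤ InformationTheory.klFun p := by
  rcases hp.eq_or_lt with rfl | hp
  · simp [InformationTheory.klFun]
  have hu : 0 < √p := Real.sqrt_pos.2 hp
  have hsq : √p ^ 2 = p := Real.sq_sqrt hp.le
  have hlog : Real.log p = 2 * Real.log (√p) := by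
    rw [Real.log_sqrt hp.le]; ring
  have h1 : 1 - (√p)⁻¹ ≤ Real.log (√p) := Real.one_sub_inv_le_log_of_pos hu
  have h2 : p * (1 - (√p)⁻¹) = p - √p := by
    field_simp
    nlinarith
  rw [InformationTheory.klFun, hlog]
  nlinarith [mul_le_mul_of_nonneg_left h1 hp.le]

lemma integrable_of_bounded {m : Measure α} [IsFiniteMeasure m] {G : α → ℝ} (hG : Measurable G)
    {B : ℝ} (hB : ∀ x, |G x| ≤ B) : Integrable G m :=
  Integrable.of_bound hG.aestronglyMeasurable B (Eventually.of_forall hB)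

/-- The Hellinger-type bound of a difference of expectations by the Kullback–Leibler divergence. -/
lemma sq_integral_sub_le_of_klDiv_le {P Q : Measure α} [IsProbabilityMeasure P]
    [IsProbabilityMeasure Q] {k : ℝ} (hk : 0 ≤ k)
    (h : InformationTheory.klDiv P Q ≤ ENNReal.ofReal k) {G : α → ℝ} (hG : Measurable G)
    {B : ℝ} (hB : ∀ x, |G x| ≤ B) :
    (∫ x, G x ∂P - ∫ x, G x ∂Q) ^ 2 ≤ k * (2 * (∫ x, G x ^ 2 ∂P + ∫ x, G x ^ 2 ∂Q)) := by
  have hne : InformationTheory.klDiv P Q ≠ ∞ := ne_top_of_le_ne_top ENNReal.ofReal_ne_top h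
  obtain ⟨hac, hint⟩ := InformationTheory.klDiv_ne_top_iff.1 hne
  set p : α → ℝ := fun x => (P.rnDeriv Q x).toReal with hp
  have hpm : Measurable p := (Measure.measurable_rnDeriv P Q).ennreal_toReal
  have hp0 : ∀ x, 0 ≤ p x := fun x => ENNReal.toReal_nonneg
  have hpi : Integrable p Q := Measure.integrable_toReal_rnDeriv
  have hkl : Integrable (fun x => InformationTheory.klFun (p x)) Q :=
    (InformationTheory.integrable_klFun_rnDeriv_iff hac).2 hint
  have hkl' : ∫ x, InformationTheory.klFun (p x) ∂Q ≤ k := by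
    rw [← InformationTheory.toReal_klDiv_eq_integral_klFun hac]
    exact ENNReal.toReal_le_of_le_ofReal hk h
  have hsq : MemLp (fun x => √(p x)) 2 Q := by
    rw [memLp_two_iff_integrable_sq hpm.sqrt.aestronglyMeasurable]
    exact hpi.congr (Eventually.of_forall fun x => (Real.sq_sqrt (hp0 x)).symm)
  have h1 : MemLp (fun x => √(p x) - 1) 2 Q := hsq.sub (memLp_const 1)
  have hB2 : ∀ x, |G x ^ 2| ≤ B ^ 2 := fun x => by
    rw [abs_pow]; exact pow_le_pow_left₀ (abs_nonneg _) (hB x) 2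
  have hs1 : MemLp (fun x => √(p x) + 1) 2 Q := hsq.add (memLp_const 1)
  have h2 : MemLp (fun x => G x * (√(p x) + 1)) 2 Q := by
    have hm : Measurable fun x => G x * (√(p x) + 1) := hG.mul (hpm.sqrt.add_const 1)
    rw [memLp_two_iff_integrable_sq hm.aestronglyMeasurable]
    simp only [mul_pow]
    exact hs1.integrable_sq.bdd_mul (hG.pow_const 2).aestronglyMeasurable
      (Eventually.of_forall hB2)
  have hP : ∀ F : α → ℝ, ∫ x, F x ∂P = ∫ x, p x * F x ∂Q := fun F =>
    (integral_rnDeriv_smul hac).symm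
  have hpG : Integrable (fun x => p x * G x) Q :=
    hpi.mul_bdd hG.aestronglyMeasurable (Eventually.of_forall hB)
  have hpG2 : Integrable (fun x => p x * G x ^ 2) Q :=
    hpi.mul_bdd (hG.pow_const 2).aestronglyMeasurable (Eventually.of_forall hB2)
  have hG2 : Integrable (fun x => G x ^ 2) Q := integrable_of_bounded (hG.pow_const 2) hB2
  -- Factor p − 1 = (√p − 1)(√p + 1). The first factor carries the divergence; the second is
  -- controlled by (√p + 1)² ≤ 2(p + 1), which produces the expectations of G² under both laws.
  have e1 : ∫ x, G x ∂P - ∫ x, G x ∂Q = ∫ x, (√(p x) - 1) * (G x * (√(p x) + 1)) ∂Q := by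
    rw [hP, ← integral_sub hpG (integrable_of_bounded hG hB)]
    refine integral_congr_ae (Eventually.of_forall fun x => ?_)
    have := Real.sq_sqrt (hp0 x)
    simp only
    linear_combination (-G x) * this
  have e2 : ∫ x, (G x * (√(p x) + 1)) ^ 2 ∂Q ≤ 2 * (∫ x, G x ^ 2 ∂P + ∫ x, G x ^ 2 ∂Q) := by
    rw [hP, ← integral_add hpG2 hG2, ← integral_const_mul]
    refine integral_mono h2.integrable_sq ((hpG2.add hG2).const_mul 2) fun x => ?_
    have := Real.sq_sqrt (hp0 x)
    simp only
    nlinarith [mul_nonneg (sq_nonneg (G x)) (sq_nonneg (√(p x) - 1))]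
  have e3 : ∫ x, (√(p x) - 1) ^ 2 ∂Q ≤ k :=
    (integral_mono h1.integrable_sq hkl fun x => sq_sqrt_sub_one_le_klFun (hp0 x)).trans hkl'
  rw [e1]
  refine (sq_integral_mul_le h1 h2).trans ?_
  exact mul_le_mul e3 e2 (integral_nonneg fun x => sq_nonneg _) hk

end Inequalities

variable {𝓧 : Type*} [MeasurableSpace 𝓧]

lemma measurable_integral_push {m : Measure 𝓧} [SFinite m] {n : ℕ} {G : (Fin (n + 1) → 𝓧) → ℝ}
    (hG : Measurable G) : Measurable fun x : Fin n → 𝓧 => ∫ y, G (push x y) ∂m :=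
  (StronglyMeasurable.integral_prod_right
    (f := fun (x : Fin n → 𝓧) y => G (push x y))
    (hG.comp (measurable_push n)).stronglyMeasurable).measurable

/-! ### Moments of the cumulative score. -/

section Scores

/-- The sum of the scores of the first `n` observations. -/
def scoreSum (q : ℕ → 𝓧 → ℝ) (n : ℕ) (x : Fin n → 𝓧) : ℝ := ∑ i : Fin n, q i (x i)

omit [MeasurableSpace 𝓧] in
lemma scoreSum_succ (q : ℕ → 𝓧 → ℝ) (n : ℕ) (x : Fin (n + 1) → 𝓧) :
    scoreSum q (n + 1) x = scoreSum q n (pop x) + q n (x (Fin.last n)) := by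
  simp [scoreSum, Fin.sum_univ_castSucc, pop]

omit [MeasurableSpace 𝓧] in
@[simp] lemma scoreSum_push (q : ℕ → 𝓧 → ℝ) (n : ℕ) (x : Fin n → 𝓧) (y : 𝓧) :
    scoreSum q (n + 1) (push x y) = scoreSum q n x + q n y := by
  simp [scoreSum_succ]

variable {q : ℕ → 𝓧 → ℝ}

variable {ν : ℕ → Measure 𝓧} [∀ n, IsProbabilityMeasure (ν n)]

lemma memLp_scoreSum (hq2 : ∀ n, MemLp (q n) 2 (ν n)) (n : ℕ) :
    MemLp (scoreSum q n) 2 (law ν n) := by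
  induction n with
  | zero =>
    have : scoreSum q 0 = fun _ : Fin 0 → 𝓧 => (0 : ℝ) := by ext x; simp [scoreSum]
    rw [this]
    exact memLp_const 0
  | succ n ih =>
    have h1 := ih.comp_measurePreserving (measurePreserving_pop ν n)
    have h2 := (hq2 n).comp_measurePreserving (measurePreserving_eval_last ν n)
    have : scoreSum q (n + 1) = scoreSum q n ∘ pop
        + q n ∘ fun x : Fin (n + 1) → 𝓧 => x (Fin.last n) := by
      ext x; simp [scoreSum_succ]
    rw [this]
    exact h1.add h2

/-- Given the first `n` observations the cross term has mean zero, so second moments add up. -/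
lemma integral_scoreSum_sq_le (hq2 : ∀ n, MemLp (q n) 2 (ν n))
    (hq0 : ∀ n, ∫ y, q n y ∂ν n = 0) {σ2 : ℝ} (hσ : ∀ n, ∫ y, q n y ^ 2 ∂ν n ≤ σ2) (n : ℕ) :
    ∫ x, scoreSum q n x ^ 2 ∂law ν n ≤ n * σ2 := by
  induction n with
  | zero => simp [scoreSum]
  | succ n ih =>
    rw [integral_law_succ (memLp_scoreSum hq2 (n + 1)).integrable_sq]
    have e : ∀ x : Fin n → 𝓧, ∫ y, scoreSum q (n + 1) (push x y) ^ 2 ∂ν n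
        = scoreSum q n x ^ 2 + ∫ y, q n y ^ 2 ∂ν n := by
      intro x
      have hi := (hq2 n).integrable one_le_two
      have h1 : Integrable (fun y => scoreSum q n x ^ 2 + 2 * scoreSum q n x * q n y) (ν n) :=
        (integrable_const _).add (hi.const_mul _)
      have e1 : (fun y => scoreSum q (n + 1) (push x y) ^ 2)
          = fun y => (scoreSum q n x ^ 2 + 2 * scoreSum q n x * q n y) + q n y ^ 2 := by
        ext y; rw [scoreSum_push]; ring
      rw [e1, integral_add h1 (hq2 n).integrable_sq,
        integral_add (integrable_const _) (hi.const_mul _), integral_const_mul, hq0]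
      simp
    simp_rw [e]
    rw [integral_add (memLp_scoreSum hq2 n).integrable_sq (integrable_const _)]
    have := hσ n
    simp only [integral_const, probReal_univ, smul_eq_mul, one_mul]
    push_cast
    linarith

lemma integral_abs_scoreSum_le (hq2 : ∀ n, MemLp (q n) 2 (ν n)) {A : ℝ}
    (hA : ∀ n, ∫ y, |q n y| ∂ν n ≤ A) (n : ℕ) :
    ∫ x, |scoreSum q n x| ∂law ν n ≤ n * A := by
  induction n with
  | zero => simp [scoreSum]
  | succ n ih =>
    have hi := ((memLp_scoreSum hq2 n).integrable one_le_two).abs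
    have hqi := ((hq2 n).integrable one_le_two).abs
    have h1 : Integrable (fun x => |scoreSum q n (pop x)|) (law ν (n + 1)) :=
      (measurePreserving_pop ν n).integrable_comp_of_integrable hi
    have h2 : Integrable (fun x : Fin (n + 1) → 𝓧 => |q n (x (Fin.last n))|) (law ν (n + 1)) :=
      (measurePreserving_eval_last ν n).integrable_comp_of_integrable hqi
    have e1 : ∫ x, |scoreSum q n (pop x)| ∂law ν (n + 1) = ∫ x, |scoreSum q n x| ∂law ν n :=
      integral_pop ν hi.1
    have e2 : ∫ x : Fin (n + 1) → 𝓧, |q n (x (Fin.last n))| ∂law ν (n + 1)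
        = ∫ y, |q n y| ∂ν n := by
      rw [integral_law_succ h2]; simp
    calc ∫ x, |scoreSum q (n + 1) x| ∂law ν (n + 1)
        ≤ ∫ x, (|scoreSum q n (pop x)| + |q n (x (Fin.last n))|) ∂law ν (n + 1) := by
          refine integral_mono ((memLp_scoreSum hq2 (n + 1)).integrable one_le_two).abs
            (h1.add h2) fun x => ?_
          simp only [scoreSum_succ]
          exact abs_add_le _ _
      _ = ∫ x, |scoreSum q n x| ∂law ν n + ∫ y, |q n y| ∂ν n := by
          rw [integral_add h1 h2, e1, e2]
      _ ≤ _ := by have := hA n; push_cast; linarith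

end Scores

/-! ### The distribution and tails of the stopping time. -/

section Survival

lemma Rule.nonneg (ψ : Rule 𝓧) (n : ℕ) (x : Fin n → 𝓧) : 0 ≤ ψ.val n x := (ψ.mem_Icc n x).1

lemma Rule.le_one (ψ : Rule 𝓧) (n : ℕ) (x : Fin n → 𝓧) : ψ.val n x ≤ 1 := (ψ.mem_Icc n x).2

/-- The conditional probability of going on after stage `n`, given the first `n` observations. -/
def cont (ψ : Rule 𝓧) : (n : ℕ) → (Fin n → 𝓧) → ℝ
  | 0, _ => 1
  | n + 1, x => cont ψ n (pop x) * (1 - ψ.val (n + 1) x)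

/-- `t` at stage n + 1 depends on the first `n` observations only; `cont` records it as a function
of these, one index lower. -/
lemma t_succ (ψ : Rule 𝓧) (n : ℕ) (x : Fin (n + 1) → 𝓧) : t ψ (n + 1) x = cont ψ n (pop x) := by
  induction n with
  | zero => simp [t, cont]
  | succ n ih =>
    rw [t, cont]
    exact congrArg (· * (1 - ψ.val (n + 1) (pop x))) (ih (pop x))

lemma s_succ (ψ : Rule 𝓧) (n : ℕ) (x : Fin (n + 1) → 𝓧) :
    s ψ (n + 1) x = cont ψ n (pop x) * ψ.val (n + 1) x := by
  rw [s, t_succ]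

lemma cont_mem_Icc (ψ : Rule 𝓧) (n : ℕ) (x : Fin n → 𝓧) : cont ψ n x ∈ Set.Icc (0 : ℝ) 1 := by
  induction n with
  | zero => simp [cont]
  | succ n ih =>
    have h1 := ih (pop x)
    have h2 := ψ.mem_Icc (n + 1) x
    exact ⟨mul_nonneg h1.1 (by linarith [h2.2]),
      mul_le_one₀ h1.2 (by linarith [h2.2]) (by linarith [h2.1])⟩

lemma cont_nonneg (ψ : Rule 𝓧) (n : ℕ) (x : Fin n → 𝓧) : 0 ≤ cont ψ n x := (cont_mem_Icc ψ n x).1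

lemma cont_le_one (ψ : Rule 𝓧) (n : ℕ) (x : Fin n → 𝓧) : cont ψ n x ≤ 1 := (cont_mem_Icc ψ n x).2

lemma abs_cont_le_one (ψ : Rule 𝓧) (n : ℕ) (x : Fin n → 𝓧) : |cont ψ n x| ≤ 1 := by
  rw [abs_of_nonneg (cont_nonneg ψ n x)]; exact cont_le_one ψ n x

lemma measurable_cont (ψ : Rule 𝓧) (n : ℕ) : Measurable (cont ψ n) := by
  induction n with
  | zero => exact measurable_const
  | succ n ih =>
    exact (ih.comp (measurable_pop n)).mul ((ψ.measurable_val _).const_sub 1)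

lemma measurable_s_succ (ψ : Rule 𝓧) (n : ℕ) : Measurable (s ψ (n + 1)) := by
  have : s ψ (n + 1) = fun x => cont ψ n (pop x) * ψ.val (n + 1) x := by
    ext x; exact s_succ ψ n x
  rw [this]
  exact ((measurable_cont ψ n).comp (measurable_pop n)).mul (ψ.measurable_val _)

lemma s_succ_nonneg (ψ : Rule 𝓧) (n : ℕ) (x : Fin (n + 1) → 𝓧) : 0 ≤ s ψ (n + 1) x := by
  rw [s_succ]; exact mul_nonneg (cont_nonneg _ _ _) (ψ.nonneg _ _)

lemma s_succ_le_one (ψ : Rule 𝓧) (n : ℕ) (x : Fin (n + 1) → 𝓧) : s ψ (n + 1) x ≤ 1 := by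
  rw [s_succ]; exact mul_le_one₀ (cont_le_one _ _ _) (ψ.nonneg _ _) (ψ.le_one _ _)

lemma abs_s_succ_le_one (ψ : Rule 𝓧) (n : ℕ) (x : Fin (n + 1) → 𝓧) : |s ψ (n + 1) x| ≤ 1 := by
  rw [abs_of_nonneg (s_succ_nonneg ψ n x)]; exact s_succ_le_one ψ n x

lemma s_add_cont (ψ : Rule 𝓧) (n : ℕ) (x : Fin (n + 1) → 𝓧) :
    s ψ (n + 1) x + cont ψ (n + 1) x = cont ψ n (pop x) := by
  rw [s_succ, cont]; ring

variable (ν : ℕ → Measure 𝓧)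

/-- The probability of going on after stage `n`. -/
noncomputable def surv (ψ : Rule 𝓧) (n : ℕ) : ℝ := ∫ x, cont ψ n x ∂law ν n

/-- The probability of stopping at stage `n`. -/
noncomputable def stopMass (ψ : Rule 𝓧) (n : ℕ) : ℝ := ∫ x, s ψ n x ∂law ν n

lemma surv_nonneg (ψ : Rule 𝓧) (n : ℕ) : 0 ≤ surv ν ψ n :=
  integral_nonneg fun x => cont_nonneg ψ n x

lemma stopMass_nonneg (ψ : Rule 𝓧) (n : ℕ) : 0 ≤ stopMass ν ψ (n + 1) :=
  integral_nonneg fun x => s_succ_nonneg ψ n x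

lemma surv_zero (ψ : Rule 𝓧) : surv ν ψ 0 = 1 := by
  rw [surv, integral_law_zero, cont]

variable [∀ n, IsProbabilityMeasure (ν n)]

lemma integrable_cont (ψ : Rule 𝓧) (n : ℕ) : Integrable (cont ψ n) (law ν n) :=
  integrable_of_bounded (measurable_cont ψ n) (abs_cont_le_one ψ n)

lemma integrable_s_succ (ψ : Rule 𝓧) (n : ℕ) : Integrable (s ψ (n + 1)) (law ν (n + 1)) :=
  integrable_of_bounded (measurable_s_succ ψ n) (abs_s_succ_le_one ψ n)

lemma stopMass_succ (ψ : Rule 𝓧) (n : ℕ) :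
    stopMass ν ψ (n + 1) = surv ν ψ n - surv ν ψ (n + 1) := by
  have h : surv ν ψ n = ∫ x, (s ψ (n + 1) x + cont ψ (n + 1) x) ∂law ν (n + 1) := by
    simp_rw [s_add_cont]
    exact (integral_pop ν (measurable_cont ψ n).aestronglyMeasurable).symm
  rw [h, integral_add (integrable_s_succ ν ψ n) (integrable_cont ν ψ (n + 1))]
  simp [stopMass, surv]

lemma sum_stopMass (ψ : Rule 𝓧) (N : ℕ) :
    ∑ i ∈ Finset.range N, stopMass ν ψ (i + 1) = 1 - surv ν ψ N := by
  induction N with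
  | zero => simp [surv_zero]
  | succ N ih => rw [Finset.sum_range_succ, ih, stopMass_succ]; ring

/-- Summation by parts: the sum of P(τ > i) over i < N equals E[τ; τ ≤ N] + N P(τ > N). -/
lemma sum_surv (ψ : Rule 𝓧) (N : ℕ) :
    ∑ i ∈ Finset.range N, surv ν ψ i
      = ∑ i ∈ Finset.range N, ((i + 1 : ℕ) : ℝ) * stopMass ν ψ (i + 1) + N * surv ν ψ N := by
  induction N with
  | zero => simp
  | succ N ih =>
    rw [Finset.sum_range_succ, Finset.sum_range_succ, ih, stopMass_succ]; push_cast; ring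

lemma summable_stopMass (ψ : Rule 𝓧) : Summable fun n => stopMass ν ψ (n + 1) :=
  summable_of_sum_range_le (c := 1) (stopMass_nonneg ν ψ) fun N => by
    rw [sum_stopMass]; linarith [surv_nonneg ν ψ N]

/-- The stopping time is finite almost surely and has a finite mean. -/
structure FiniteMean (ψ : Rule 𝓧) : Prop where
  tsum_eq_one : ∑' n, stopMass ν ψ (n + 1) = 1
  summable_mul : Summable fun n : ℕ => ((n + 1 : ℕ) : ℝ) * stopMass ν ψ (n + 1)

variable {ν} {ψ : Rule 𝓧}

lemma FiniteMean.surv_eq (h : FiniteMean ν ψ) (N : ℕ) :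
    surv ν ψ N = ∑' i, stopMass ν ψ (i + N + 1) := by
  have := (summable_stopMass ν ψ).sum_add_tsum_nat_add N
  rw [sum_stopMass, h.tsum_eq_one] at this
  linarith

/-- Markov's argument on the tail: on {τ > N} one has τ ≥ N + 1. The right side is the tail of a
convergent series, so the left side tends to 0. -/
lemma FiniteMean.mul_surv_le (h : FiniteMean ν ψ) (N : ℕ) :
    ((N + 1 : ℕ) : ℝ) * surv ν ψ N
      ≤ ∑' i : ℕ, ((i + N + 1 : ℕ) : ℝ) * stopMass ν ψ (i + N + 1) := by
  rw [h.surv_eq, ← tsum_mul_left]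
  refine Summable.tsum_le_tsum (fun i => ?_)
    (((summable_nat_add_iff N).2 (summable_stopMass ν ψ)).mul_left _)
    ((summable_nat_add_iff N).2 h.summable_mul)
  refine mul_le_mul_of_nonneg_right ?_ (stopMass_nonneg ν ψ _)
  exact_mod_cast (by omega : N + 1 ≤ i + N + 1)

lemma FiniteMean.tendsto_mul_surv (h : FiniteMean ν ψ) :
    Tendsto (fun N : ℕ => ((N + 1 : ℕ) : ℝ) * surv ν ψ N) atTop (𝓝 0) :=
  squeeze_zero (fun N => mul_nonneg (Nat.cast_nonneg _) (surv_nonneg ν ψ N)) h.mul_surv_le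
    (tendsto_sum_nat_add fun n : ℕ => ((n + 1 : ℕ) : ℝ) * stopMass ν ψ (n + 1))

lemma FiniteMean.tendsto_surv (h : FiniteMean ν ψ) : Tendsto (surv ν ψ) atTop (𝓝 0) := by
  refine squeeze_zero (surv_nonneg ν ψ) (fun N => ?_) h.tendsto_mul_surv
  have : (1 : ℝ) ≤ ((N + 1 : ℕ) : ℝ) := by exact_mod_cast Nat.succ_le_succ (Nat.zero_le N)
  nlinarith [surv_nonneg ν ψ N]

lemma FiniteMean.summable_surv (h : FiniteMean ν ψ) : Summable (surv ν ψ) := by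
  obtain ⟨K, hK⟩ := h.tendsto_mul_surv.bddAbove_range
  refine summable_of_sum_range_le
    (c := (∑' i : ℕ, ((i + 1 : ℕ) : ℝ) * stopMass ν ψ (i + 1)) + K) (surv_nonneg ν ψ) fun N => ?_
  have h1 : ∑ i ∈ Finset.range N, ((i + 1 : ℕ) : ℝ) * stopMass ν ψ (i + 1) ≤ _ :=
    h.summable_mul.sum_le_tsum _ fun i _ => mul_nonneg (Nat.cast_nonneg _) (stopMass_nonneg ν ψ i)
  have h2 := hK ⟨N, rfl⟩
  rw [sum_surv]
  push_cast at h1 h2 ⊢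
  nlinarith [surv_nonneg ν ψ N]

/-- The stopped cumulative score is asymptotically negligible on `{τ > N}`. -/
lemma FiniteMean.tendsto_cont_mul_abs_scoreSum (h : FiniteMean ν ψ) {q : ℕ → 𝓧 → ℝ}
    (hq2 : ∀ n, MemLp (q n) 2 (ν n)) (hq0 : ∀ n, ∫ y, q n y ∂ν n = 0) {σ2 : ℝ}
    (hσ : ∀ n, ∫ y, q n y ^ 2 ∂ν n ≤ σ2) :
    Tendsto (fun N => ∫ x, cont ψ N x * |scoreSum q N x| ∂law ν N) atTop (𝓝 0) := by
  have hσ0 : 0 ≤ σ2 := (integral_nonneg fun y => sq_nonneg _).trans (hσ 0)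
  -- Cauchy–Schwarz: `cont` takes values in [0, 1], so its square has mean at most P(τ > N), while
  -- the score has second moment at most N σ².
  have key : ∀ N, (∫ x, cont ψ N x * |scoreSum q N x| ∂law ν N) ^ 2
      ≤ σ2 * (((N + 1 : ℕ) : ℝ) * surv ν ψ N) := by
    intro N
    have hc : MemLp (cont ψ N) 2 (law ν N) :=
      MemLp.of_bound (measurable_cont ψ N).aestronglyMeasurable 1
        (Eventually.of_forall (abs_cont_le_one ψ N))
    have h1 := sq_integral_mul_le hc (memLp_scoreSum hq2 N).abs
    have h2 : ∫ x, cont ψ N x ^ 2 ∂law ν N ≤ surv ν ψ N := by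
      refine integral_mono hc.integrable_sq (integrable_cont ν ψ N) fun x => ?_
      have := cont_mem_Icc ψ N x
      simp only
      nlinarith [this.1, this.2]
    have h3 := integral_scoreSum_sq_le hq2 hq0 hσ N
    simp only [Pi.abs_apply, sq_abs] at h1
    refine h1.trans ((mul_le_mul h2 h3 (integral_nonneg fun _ => sq_nonneg _)
      (surv_nonneg ν ψ N)).trans ?_)
    push_cast
    nlinarith [mul_nonneg hσ0 (surv_nonneg ν ψ N)]
  have h0 : Tendsto (fun N => (∫ x, cont ψ N x * |scoreSum q N x| ∂law ν N) ^ 2) atTop (𝓝 0) :=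
    squeeze_zero (fun N => sq_nonneg _) key (by simpa using h.tendsto_mul_surv.const_mul σ2)
  have h1 := h0.sqrt
  simp only [Real.sqrt_zero] at h1
  refine h1.congr fun N => Real.sqrt_sq (integral_nonneg fun x => ?_)
  exact mul_nonneg (cont_nonneg ψ N x) (abs_nonneg _)

end Survival

/-! ### Rejection probabilities after a given stage. -/

section Rejection

variable (m : ℕ → Measure 𝓧)

/-- The probability of stopping at stage `n` and rejecting. -/
noncomputable def rejProb (ψ φ : Rule 𝓧) (n : ℕ) : ℝ := ∫ x, s ψ n x * φ.val n x ∂law m n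

/-- The conditional probability of rejecting at one of the `k` stages after stage `n`, given the
first `n` observations and that the test goes on after them. -/
noncomputable def condRej (ψ φ : Rule 𝓧) : (k n : ℕ) → (Fin n → 𝓧) → ℝ
  | 0, _, _ => 0
  | k + 1, n, x => ∫ y, (ψ.val (n + 1) (push x y) * φ.val (n + 1) (push x y)
      + (1 - ψ.val (n + 1) (push x y)) * condRej ψ φ k (n + 1) (push x y)) ∂m n

/-- The integrand in the backward recursion for `condRej`. -/
noncomputable def condRejStep (ψ φ : Rule 𝓧) (k n : ℕ) (x : Fin (n + 1) → 𝓧) : ℝ :=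
  ψ.val (n + 1) x * φ.val (n + 1) x + (1 - ψ.val (n + 1) x) * condRej m ψ φ k (n + 1) x

lemma condRej_succ (ψ φ : Rule 𝓧) (k n : ℕ) (x : Fin n → 𝓧) :
    condRej m ψ φ (k + 1) n x = ∫ y, condRejStep m ψ φ k n (push x y) ∂m n := rfl

variable [∀ n, IsProbabilityMeasure (m n)]

lemma measurable_condRej (ψ φ : Rule 𝓧) (k n : ℕ) : Measurable (condRej m ψ φ k n) := by
  induction k generalizing n with
  | zero => exact measurable_const
  | succ k ih =>
    exact measurable_integral_push (((ψ.measurable_val _).mul (φ.measurable_val _)).add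
      (((ψ.measurable_val _).const_sub 1).mul (ih (n + 1))))

lemma measurable_condRejStep (ψ φ : Rule 𝓧) (k n : ℕ) : Measurable (condRejStep m ψ φ k n) :=
  ((ψ.measurable_val _).mul (φ.measurable_val _)).add
      (((ψ.measurable_val _).const_sub 1).mul (measurable_condRej m ψ φ k (n + 1)))

lemma condRej_mem_Icc (ψ φ : Rule 𝓧) (k n : ℕ) :
    (∀ x, condRej m ψ φ k n x ∈ Set.Icc (0 : ℝ) 1)
      ∧ ∀ x, condRejStep m ψ φ k n x ∈ Set.Icc (0 : ℝ) 1 := by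
  have step : ∀ k n, (∀ x, condRej m ψ φ k (n + 1) x ∈ Set.Icc (0 : ℝ) 1) →
      ∀ x, condRejStep m ψ φ k n x ∈ Set.Icc (0 : ℝ) 1 := by
    intro k n h x
    obtain ⟨h1, h2⟩ := h x
    obtain ⟨p1, p2⟩ := ψ.mem_Icc (n + 1) x
    obtain ⟨r1, r2⟩ := φ.mem_Icc (n + 1) x
    simp only [condRejStep]
    constructor
    · have := mul_nonneg p1 r1
      have := mul_nonneg (sub_nonneg.2 p2) h1
      linarith
    · nlinarith [mul_nonneg p1 (sub_nonneg.2 r2), mul_nonneg (sub_nonneg.2 p2) (sub_nonneg.2 h2)]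
  have main : ∀ k n, ∀ x, condRej m ψ φ k n x ∈ Set.Icc (0 : ℝ) 1 := by
    intro k
    induction k with
    | zero => intro n x; simp [condRej]
    | succ k ih =>
      intro n x
      have hs := step k n (ih (n + 1))
      have hi : Integrable (fun y => condRejStep m ψ φ k n (push x y)) (m n) :=
        integrable_of_bounded ((measurable_condRejStep m ψ φ k n).comp (measurable_push_right x))
          (B := 1) fun y => by rw [abs_of_nonneg (hs _).1]; exact (hs _).2
      rw [condRej_succ]
      refine ⟨integral_nonneg fun y => (hs _).1, ?_⟩
      calc _ ≤ ∫ _, (1 : ℝ) ∂m n := integral_mono hi (integrable_const _) fun y => (hs _).2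
        _ = 1 := by simp
  exact ⟨main k n, step k n (main k (n + 1))⟩

lemma abs_condRej_le_one (ψ φ : Rule 𝓧) (k n : ℕ) (x : Fin n → 𝓧) :
    |condRej m ψ φ k n x| ≤ 1 := by
  have := (condRej_mem_Icc m ψ φ k n).1 x
  rw [abs_of_nonneg this.1]; exact this.2

lemma abs_condRejStep_le_one (ψ φ : Rule 𝓧) (k n : ℕ) (x : Fin (n + 1) → 𝓧) :
    |condRejStep m ψ φ k n x| ≤ 1 := by
  have := (condRej_mem_Icc m ψ φ k n).2 x
  rw [abs_of_nonneg this.1]; exact this.2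

lemma abs_mul_le_one {a b : ℝ} (ha : |a| ≤ 1) (hb : |b| ≤ 1) : |a * b| ≤ 1 := by
  rw [abs_mul]; exact mul_le_one₀ ha (abs_nonneg _) hb

lemma Rule.abs_le_one (ψ : Rule 𝓧) (n : ℕ) (x : Fin n → 𝓧) : |ψ.val n x| ≤ 1 := by
  rw [abs_of_nonneg (ψ.nonneg n x)]; exact ψ.le_one n x

lemma abs_s_mul_le_one (ψ φ : Rule 𝓧) (n : ℕ) (x : Fin (n + 1) → 𝓧) :
    |s ψ (n + 1) x * φ.val (n + 1) x| ≤ 1 :=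
  abs_mul_le_one (abs_s_succ_le_one ψ n x) (φ.abs_le_one _ x)

lemma measurable_s_mul (ψ φ : Rule 𝓧) (n : ℕ) :
    Measurable fun x => s ψ (n + 1) x * φ.val (n + 1) x :=
  (measurable_s_succ ψ n).mul (φ.measurable_val _)

omit [∀ n, IsProbabilityMeasure (m n)] in
lemma rejProb_nonneg (ψ φ : Rule 𝓧) (n : ℕ) : 0 ≤ rejProb m ψ φ (n + 1) :=
  integral_nonneg fun x => mul_nonneg (s_succ_nonneg ψ n x) (φ.nonneg _ x)

lemma rejProb_le_stopMass (ψ φ : Rule 𝓧) (n : ℕ) :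
    rejProb m ψ φ (n + 1) ≤ stopMass m ψ (n + 1) := by
  refine integral_mono (integrable_of_bounded (measurable_s_mul ψ φ n) (abs_s_mul_le_one ψ φ n))
    (integrable_s_succ m ψ n) fun x => ?_
  exact mul_le_of_le_one_right (s_succ_nonneg ψ n x) (φ.le_one _ x)

lemma summable_rejProb (ψ φ : Rule 𝓧) : Summable fun n => rejProb m ψ φ (n + 1) :=
  Summable.of_nonneg_of_le (rejProb_nonneg m ψ φ) (rejProb_le_stopMass m ψ φ)
    (summable_stopMass m ψ)

lemma integrable_cont_mul {ψ : Rule 𝓧} {n : ℕ} {G : (Fin n → 𝓧) → ℝ} (hG : Measurable G) {B : ℝ}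
    (hB : ∀ x, |G x| ≤ B) : Integrable (fun x => cont ψ n x * G x) (law m n) :=
  (integrable_of_bounded hG hB).bdd_mul (measurable_cont ψ n).aestronglyMeasurable
    (Eventually.of_forall (abs_cont_le_one ψ n))

/-- Condition on the first `n` observations. The laws of these enter only through the outer integral
and those of later observations only through `condRej`, so the two can be exchanged separately. -/
lemma sum_rejProb (ψ φ : Rule 𝓧) (k n : ℕ) :
    ∑ i ∈ Finset.range k, rejProb m ψ φ (n + i + 1)
      = ∫ x, cont ψ n x * condRej m ψ φ k n x ∂law m n := by
  induction k generalizing n with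
  | zero => simp [condRej]
  | succ k ih =>
    have h1 : Integrable (fun x => s ψ (n + 1) x * φ.val (n + 1) x) (law m (n + 1)) :=
      integrable_of_bounded (measurable_s_mul ψ φ n) (abs_s_mul_le_one ψ φ n)
    have h2 : Integrable (fun x => cont ψ (n + 1) x * condRej m ψ φ k (n + 1) x)
        (law m (n + 1)) :=
      integrable_cont_mul m (measurable_condRej m ψ φ k (n + 1)) (abs_condRej_le_one m ψ φ k _)
    have e : ∀ x : Fin (n + 1) → 𝓧, s ψ (n + 1) x * φ.val (n + 1) x
        + cont ψ (n + 1) x * condRej m ψ φ k (n + 1) x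
        = cont ψ n (pop x) * condRejStep m ψ φ k n x := by
      intro x; rw [s_succ, cont, condRejStep]; ring
    have h3 := h1.add h2
    rw [Finset.sum_range_succ']
    have hs : ∀ i, n + (i + 1) + 1 = (n + 1) + i + 1 := fun i => by omega
    simp only [hs, ih (n + 1), Nat.add_zero]
    rw [rejProb, add_comm, ← integral_add h1 h2]
    simp_rw [e]
    rw [integral_law_succ (h3.congr (Eventually.of_forall e))]
    simp only [pop_push, integral_const_mul, condRej_succ]

variable (ν : ℕ → Measure 𝓧) [∀ n, IsProbabilityMeasure (ν n)]

/-- Exchanging the laws of the observations after stage `n` changes the conditional rejection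
probability by at most a multiple of the expected number of remaining observations. -/
lemma integral_cont_mul_abs_condRej_sub_le {C : ℝ}
    (hC : ∀ n, ∀ G : 𝓧 → ℝ, Measurable G → (∀ x, |G x| ≤ 1) →
      |∫ y, G y ∂m n - ∫ y, G y ∂ν n| ≤ C) (ψ φ : Rule 𝓧) (k n : ℕ) :
    ∫ x, cont ψ n x * |condRej m ψ φ k n x - condRej ν ψ φ k n x| ∂law ν n
      ≤ C * ∑ i ∈ Finset.range k, surv ν ψ (n + i) := by
  induction k generalizing n with
  | zero => simp [condRej]
  | succ k ih =>
    have hdm : ∀ k n, Measurable fun x => |condRej m ψ φ k n x - condRej ν ψ φ k n x| :=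
      fun k n => ((measurable_condRej m ψ φ k n).sub (measurable_condRej ν ψ φ k n)).abs
    have hdb : ∀ k n x, |(|condRej m ψ φ k n x - condRej ν ψ φ k n x|)| ≤ 2 := by
      intro k n x
      rw [abs_abs]
      refine (abs_sub _ _).trans ?_
      linarith [abs_condRej_le_one m ψ φ k n x, abs_condRej_le_one ν ψ φ k n x]
    have hD : ∀ x : Fin n → 𝓧, Integrable (fun y => (1 - ψ.val (n + 1) (push x y)) *
        |condRej m ψ φ k (n + 1) (push x y) - condRej ν ψ φ k (n + 1) (push x y)|) (ν n) := by
      intro x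
      refine integrable_of_bounded (B := 2) ?_ fun y => ?_
      · exact (((ψ.measurable_val _).const_sub 1).mul (hdm k (n + 1))).comp
          (measurable_push_right x)
      · rw [abs_mul]
        have h0 := ψ.mem_Icc (n + 1) (push x y)
        rw [abs_of_nonneg (by linarith [h0.2] : (0 : ℝ) ≤ 1 - ψ.val (n + 1) (push x y))]
        nlinarith [hdb k (n + 1) (push x y), h0.1,
          abs_nonneg (|condRej m ψ φ k (n + 1) (push x y) - condRej ν ψ φ k (n + 1) (push x y)|)]
    -- Exchange the law of the next observation with the continuation under `m` kept, at a cost of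
    -- at most `C`, as the integrand lies in [0, 1]. Then compare the two continuations under the
    -- single law `ν n`.
    have hpt : ∀ x : Fin n → 𝓧, |condRej m ψ φ (k + 1) n x - condRej ν ψ φ (k + 1) n x|
        ≤ C + ∫ y, (1 - ψ.val (n + 1) (push x y)) *
          |condRej m ψ φ k (n + 1) (push x y) - condRej ν ψ φ k (n + 1) (push x y)| ∂ν n := by
      intro x
      have hm1 := (measurable_condRejStep m ψ φ k n).comp (measurable_push_right x)
      have hν1 := (measurable_condRejStep ν ψ φ k n).comp (measurable_push_right x)
      have i1 : Integrable (fun y => condRejStep m ψ φ k n (push x y)) (ν n) :=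
        integrable_of_bounded hm1 fun y => abs_condRejStep_le_one m ψ φ k n _
      have i2 : Integrable (fun y => condRejStep ν ψ φ k n (push x y)) (ν n) :=
        integrable_of_bounded hν1 fun y => abs_condRejStep_le_one ν ψ φ k n _
      have a1 := hC n (fun y => condRejStep m ψ φ k n (push x y)) hm1
        fun y => abs_condRejStep_le_one m ψ φ k n _
      have a2 : |∫ y, condRejStep m ψ φ k n (push x y) ∂ν n
          - ∫ y, condRejStep ν ψ φ k n (push x y) ∂ν n|
          ≤ ∫ y, (1 - ψ.val (n + 1) (push x y)) *
            |condRej m ψ φ k (n + 1) (push x y) - condRej ν ψ φ k (n + 1) (push x y)| ∂ν n := by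
        rw [← integral_sub i1 i2]
        refine (abs_integral_le_integral_abs).trans
          (integral_mono (i1.sub i2).abs (hD x) fun y => ?_)
        have h0 := ψ.le_one (n + 1) (push x y)
        have e : condRejStep m ψ φ k n (push x y) - condRejStep ν ψ φ k n (push x y)
            = (1 - ψ.val (n + 1) (push x y)) *
              (condRej m ψ φ k (n + 1) (push x y) - condRej ν ψ φ k (n + 1) (push x y)) := by
          simp only [condRejStep]; ring
        refine le_of_eq ((congrArg abs e).trans ?_)
        rw [abs_mul, abs_of_nonneg (sub_nonneg.2 h0)]
      rw [condRej_succ, condRej_succ]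
      refine (abs_sub_le _ (∫ y, condRejStep m ψ φ k n (push x y) ∂ν n) _).trans ?_
      linarith
    have hI : Integrable (fun x => cont ψ (n + 1) x *
        |condRej m ψ φ k (n + 1) x - condRej ν ψ φ k (n + 1) x|) (law ν (n + 1)) :=
      integrable_cont_mul ν (hdm k (n + 1)) (hdb k (n + 1))
    have hstep : ∀ x : Fin n → 𝓧, ∫ y, cont ψ (n + 1) (push x y) *
        |condRej m ψ φ k (n + 1) (push x y) - condRej ν ψ φ k (n + 1) (push x y)| ∂ν n
        = cont ψ n x * ∫ y, (1 - ψ.val (n + 1) (push x y)) *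
          |condRej m ψ φ k (n + 1) (push x y) - condRej ν ψ φ k (n + 1) (push x y)| ∂ν n := by
      intro x
      rw [← integral_const_mul]
      simp only [cont, pop_push, mul_assoc]
    have hJ : Integrable (fun x => ∫ y, cont ψ (n + 1) (push x y) *
        |condRej m ψ φ k (n + 1) (push x y) - condRej ν ψ φ k (n + 1) (push x y)| ∂ν n)
        (law ν n) := (integrable_push hI).integral_prod_left
    have hbound : ∫ x, cont ψ n x * |condRej m ψ φ (k + 1) n x - condRej ν ψ φ (k + 1) n x| ∂law ν n
        ≤ ∫ x, (C * cont ψ n x + ∫ y, cont ψ (n + 1) (push x y) *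
          |condRej m ψ φ k (n + 1) (push x y) - condRej ν ψ φ k (n + 1) (push x y)| ∂ν n)
            ∂law ν n := by
      refine integral_mono (integrable_cont_mul ν (hdm (k + 1) n) (hdb (k + 1) n))
        (((integrable_cont ν ψ n).const_mul C).add hJ) fun x => ?_
      simp only [hstep]
      have := mul_le_mul_of_nonneg_left (hpt x) (cont_nonneg ψ n x)
      linarith
    refine hbound.trans ?_
    rw [integral_add ((integrable_cont ν ψ n).const_mul C) hJ, integral_const_mul,
      ← integral_law_succ hI, Finset.sum_range_succ']
    have hs : ∑ i ∈ Finset.range k, surv ν ψ (n + (i + 1))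
        = ∑ i ∈ Finset.range k, surv ν ψ ((n + 1) + i) :=
      Finset.sum_congr rfl fun i _ => congrArg (surv ν ψ) (by omega)
    have := ih (n + 1)
    have h0 : surv ν ψ (n + 0) = surv ν ψ n := rfl
    rw [hs, h0]
    change C * surv ν ψ n + _ ≤ _
    linarith

end Rejection

/-! ### First-order expansion of product laws. -/

section ScoreExpansion

/-- The error bounds in the first-order expansion of the laws of the first `n` observations. -/
def expansionError (A h : ℝ) (ω : ℕ → ℝ) : ℕ → ℝ
  | 0 => 0
  | n + 1 => ω n + expansionError A h ω n + |h| * (A * (|h| * (n * A) + expansionError A h ω n))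

variable {m ν : ℕ → Measure 𝓧} [∀ n, IsProbabilityMeasure (m n)]
  [∀ n, IsProbabilityMeasure (ν n)] {q : ℕ → 𝓧 → ℝ}

/-- Product rule by induction: expand the law of the last observation, then that of the first `n`
for `K`, the average of `G` over the last one. The correction `Q` is integrated under `m` instead of
`ν`, but it already carries a factor `h`, so this mismatch is of second order. -/
lemma abs_integral_law_sub_le (hq : ∀ n, Measurable (q n)) (hq2 : ∀ n, MemLp (q n) 2 (ν n))
    {A : ℝ} (hA : ∀ n, ∫ y, |q n y| ∂ν n ≤ A) {h : ℝ} {ω : ℕ → ℝ}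
    (hω : ∀ n, ∀ G : 𝓧 → ℝ, Measurable G → ∀ B, (∀ y, |G y| ≤ B) →
      |∫ y, G y ∂m n - ∫ y, G y ∂ν n - h * ∫ y, G y * q n y ∂ν n| ≤ B * ω n)
    (n : ℕ) {G : (Fin n → 𝓧) → ℝ} (hG : Measurable G) {B : ℝ} (hB : ∀ x, |G x| ≤ B) :
    |∫ x, G x ∂law m n - ∫ x, G x ∂law ν n - h * ∫ x, G x * scoreSum q n x ∂law ν n|
      ≤ B * expansionError A h ω n := by
  have hi : ∀ n, Integrable (q n) (ν n) := fun n => (hq2 n).integrable one_le_two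
  have hA0 : 0 ≤ A := (integral_nonneg fun y => abs_nonneg _).trans (hA 0)
  induction n generalizing B with
  | zero => simp [integral_law_zero, scoreSum, expansionError]
  | succ n ih =>
    have hS := (memLp_scoreSum hq2 n).integrable one_le_two
    -- A probability law forces the sample space to be nonempty, so the bound is attested at some
    -- point.
    have hB0 : 0 ≤ B := by
      obtain ⟨x⟩ : Nonempty (Fin (n + 1) → 𝓧) := (law ν (n + 1)).nonempty_of_neZero
      exact (abs_nonneg _).trans (hB x)
    have hGx : ∀ x : Fin n → 𝓧, Measurable fun y => G (push x y) :=
      fun x => hG.comp (measurable_push_right x)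
    have hGi : ∀ x : Fin n → 𝓧, Integrable (fun y => G (push x y)) (ν n) :=
      fun x => integrable_of_bounded (hGx x) fun y => hB _
    have hGq : ∀ x : Fin n → 𝓧, Integrable (fun y => G (push x y) * q n y) (ν n) :=
      fun x => (hi n).bdd_mul (hGx x).aestronglyMeasurable (Eventually.of_forall fun y => hB _)
    set K' : (Fin n → 𝓧) → ℝ := fun x => ∫ y, G (push x y) ∂m n with hK'
    set K : (Fin n → 𝓧) → ℝ := fun x => ∫ y, G (push x y) ∂ν n with hK
    set Q : (Fin n → 𝓧) → ℝ := fun x => ∫ y, G (push x y) * q n y ∂ν n with hQ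
    have K'm : Measurable K' := measurable_integral_push hG
    have Km : Measurable K := measurable_integral_push hG
    have Qm : Measurable Q := by
      have := measurable_integral_push (m := ν n) (n := n)
        (G := fun x => G x * q n (x (Fin.last n))) (hG.mul ((hq n).comp (measurable_pi_apply _)))
      simpa using this
    have K'b : ∀ x, |K' x| ≤ B := fun x => by
      have := norm_integral_le_of_norm_le_const (μ := m n) (f := fun y => G (push x y))
        (Eventually.of_forall fun y => hB _)
      simpa using this
    have Kb : ∀ x, |K x| ≤ B := fun x => by
      have := norm_integral_le_of_norm_le_const (μ := ν n) (f := fun y => G (push x y))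
        (Eventually.of_forall fun y => hB _)
      simpa using this
    have Qb : ∀ x, |Q x| ≤ B * A := fun x => by
      calc |Q x| ≤ ∫ y, |G (push x y) * q n y| ∂ν n := abs_integral_le_integral_abs
        _ ≤ ∫ y, B * |q n y| ∂ν n := by
            refine integral_mono (hGq x).abs ((hi n).abs.const_mul B) fun y => ?_
            simp only [abs_mul]
            exact mul_le_mul_of_nonneg_right (hB _) (abs_nonneg _)
        _ ≤ B * A := by
            rw [integral_const_mul]; exact mul_le_mul_of_nonneg_left (hA n) hB0
    have e1 : ∫ x, G x ∂law m (n + 1) = ∫ x, K' x ∂law m n :=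
      integral_law_succ (integrable_of_bounded hG hB)
    have e2 : ∫ x, G x ∂law ν (n + 1) = ∫ x, K x ∂law ν n :=
      integral_law_succ (integrable_of_bounded hG hB)
    have KS : Integrable (fun x => K x * scoreSum q n x) (law ν n) :=
      hS.bdd_mul Km.aestronglyMeasurable (Eventually.of_forall Kb)
    have Qi : Integrable Q (law ν n) := integrable_of_bounded Qm Qb
    have e3 : ∫ x, G x * scoreSum q (n + 1) x ∂law ν (n + 1)
        = ∫ x, K x * scoreSum q n x ∂law ν n + ∫ x, Q x ∂law ν n := by
      rw [integral_law_succ (((memLp_scoreSum hq2 (n + 1)).integrable one_le_two).bdd_mul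
        hG.aestronglyMeasurable (Eventually.of_forall hB)), ← integral_add KS Qi]
      refine integral_congr_ae (Eventually.of_forall fun x => ?_)
      simp only [scoreSum_push, mul_add, hK, hQ]
      rw [integral_add ((hGi x).mul_const _) (hGq x), integral_mul_const]
    have b1 : |∫ x, K' x ∂law m n - ∫ x, K x ∂law m n - h * ∫ x, Q x ∂law m n| ≤ B * ω n := by
      have i1 : Integrable K' (law m n) := integrable_of_bounded K'm K'b
      have i2 : Integrable K (law m n) := integrable_of_bounded Km Kb
      have i3 : Integrable (fun x => h * Q x) (law m n) :=
        (integrable_of_bounded Qm Qb).const_mul h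
      have i12 : Integrable (fun x => K' x - K x) (law m n) := i1.sub i2
      rw [← integral_const_mul, ← integral_sub i1 i2, ← integral_sub i12 i3]
      have := norm_integral_le_of_norm_le_const (μ := law m n)
        (f := fun x => K' x - K x - h * Q x)
        (Eventually.of_forall fun x => hω n (fun y => G (push x y)) (hGx x) B fun y => hB _)
      simpa using this
    have b2 := ih Km Kb
    have b3 := ih Qm Qb
    have b4 : |∫ x, Q x * scoreSum q n x ∂law ν n| ≤ B * A * (n * A) := by
      calc |∫ x, Q x * scoreSum q n x ∂law ν n|
          ≤ ∫ x, |Q x * scoreSum q n x| ∂law ν n := abs_integral_le_integral_abs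
        _ ≤ ∫ x, B * A * |scoreSum q n x| ∂law ν n := by
            refine integral_mono (hS.bdd_mul Qm.aestronglyMeasurable
              (Eventually.of_forall Qb)).abs (hS.abs.const_mul _) fun x => ?_
            simp only [abs_mul]
            exact mul_le_mul_of_nonneg_right (Qb x) (abs_nonneg _)
        _ ≤ _ := by
            rw [integral_const_mul]
            exact mul_le_mul_of_nonneg_left (integral_abs_scoreSum_le hq2 hA n)
              (mul_nonneg hB0 hA0)
    have b5 : |∫ x, Q x ∂law m n - ∫ x, Q x ∂law ν n|
        ≤ |h| * (B * A * (n * A)) + B * A * expansionError A h ω n := by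
      have := abs_add_le (∫ x, Q x ∂law m n - ∫ x, Q x ∂law ν n
        - h * ∫ x, Q x * scoreSum q n x ∂law ν n) (h * ∫ x, Q x * scoreSum q n x ∂law ν n)
      rw [sub_add_cancel, abs_mul] at this
      have := mul_le_mul_of_nonneg_left b4 (abs_nonneg h)
      linarith
    rw [e1, e2, e3, expansionError]
    have hsplit : ∫ x, K' x ∂law m n - ∫ x, K x ∂law ν n
          - h * (∫ x, K x * scoreSum q n x ∂law ν n + ∫ x, Q x ∂law ν n)
        = (∫ x, K' x ∂law m n - ∫ x, K x ∂law m n - h * ∫ x, Q x ∂law m n)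
          + (∫ x, K x ∂law m n - ∫ x, K x ∂law ν n - h * ∫ x, K x * scoreSum q n x ∂law ν n)
          + h * (∫ x, Q x ∂law m n - ∫ x, Q x ∂law ν n) := by ring
    rw [hsplit]
    refine (abs_add_three _ _ _).trans ?_
    rw [abs_mul]
    have := mul_le_mul_of_nonneg_left b5 (abs_nonneg h)
    linarith

lemma isLittleO_expansionError {A θ₀ : ℝ} {ω : ℝ → ℕ → ℝ}
    (hω : ∀ n, (fun θ => ω θ n) =o[𝓝 θ₀] fun θ => θ - θ₀) (n : ℕ) :
    (fun θ => expansionError A (θ - θ₀) (ω θ) n) =o[𝓝 θ₀] fun θ => θ - θ₀ := by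
  induction n with
  | zero => simp [expansionError]
  | succ n ih =>
    have h0 : Tendsto (fun θ : ℝ => θ - θ₀) (𝓝 θ₀) (𝓝 0) := by
      have : Continuous fun θ : ℝ => θ - θ₀ := by fun_prop
      simpa using this.tendsto θ₀
    have ha : (fun θ : ℝ => |θ - θ₀|) =O[𝓝 θ₀] fun θ => θ - θ₀ := (isBigO_refl _ _).abs_left
    have hto : Tendsto (fun θ => A * (|θ - θ₀| * (n * A) + expansionError A (θ - θ₀) (ω θ) n))
        (𝓝 θ₀) (𝓝 0) := by
      have h1 : Tendsto (fun θ => |θ - θ₀|) (𝓝 θ₀) (𝓝 0) := by simpa using h0.abs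
      have h2 := ih.isBigO.trans_tendsto h0
      simpa using ((h1.mul_const (n * A)).add h2).const_mul A
    -- The last summand of the recursion is |θ − θ₀| times a quantity that tends to 0.
    have hlast := ha.mul_isLittleO ((isLittleO_one_iff ℝ).2 hto)
    simp only [mul_one] at hlast
    exact ((hω n).add ih).add hlast

end ScoreExpansion

/-! ### Differentiability of the power function. -/

section Differentiability

/-- A function with first-order expansions up to arbitrarily small multiples of the increment is
differentiable. -/
lemma exists_hasDerivAt_of_approx {f : ℝ → ℝ} {θ₀ : ℝ} {D ε : ℕ → ℝ}
    (hε : Tendsto ε atTop (𝓝 0))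
    (h : ∀ N, ∃ R : ℝ → ℝ, R =o[𝓝 θ₀] (fun θ => θ - θ₀) ∧
      ∀ᶠ θ in 𝓝 θ₀, |f θ - f θ₀ - (θ - θ₀) * D N| ≤ |θ - θ₀| * ε N + R θ) :
    ∃ d, Tendsto D atTop (𝓝 d) ∧ HasDerivAt f d θ₀ := by
  have happ : ∀ N, ∀ η > (0 : ℝ), ∀ᶠ θ in 𝓝 θ₀,
      |f θ - f θ₀ - (θ - θ₀) * D N| ≤ (ε N + η) * |θ - θ₀| := by
    intro N η hη
    obtain ⟨R, hR, hf⟩ := h N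
    filter_upwards [hf, hR.def hη] with θ h1 h2
    simp only [Real.norm_eq_abs] at h2
    linarith [le_abs_self (R θ)]
  -- Compare both expansions at one θ ≠ θ₀ and divide by |θ − θ₀|. Thus `D` is Cauchy, and the
  -- diagonal case shows ε ≥ 0.
  have hdiff : ∀ N K, |D N - D K| ≤ ε N + ε K := by
    intro N K
    refine le_of_forall_pos_le_add fun η hη => ?_
    have hev : ∀ᶠ θ in 𝓝[≠] θ₀, |D N - D K| ≤ ε N + ε K + η := by
      filter_upwards [nhdsWithin_le_nhds (happ N (η / 2) (half_pos hη)),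
        nhdsWithin_le_nhds (happ K (η / 2) (half_pos hη)), self_mem_nhdsWithin] with θ h1 h2 h3
      have hpos : 0 < |θ - θ₀| := abs_pos.2 (sub_ne_zero.2 h3)
      have h4 := abs_sub_le (f θ - f θ₀ - (θ - θ₀) * D K) 0 (f θ - f θ₀ - (θ - θ₀) * D N)
      rw [sub_zero, zero_sub, abs_neg] at h4
      have h5 : (f θ - f θ₀ - (θ - θ₀) * D K) - (f θ - f θ₀ - (θ - θ₀) * D N)
          = (θ - θ₀) * (D N - D K) := by ring
      rw [h5, abs_mul] at h4
      refine le_of_mul_le_mul_left ?_ hpos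
      linarith
    exact hev.exists.choose_spec
  have hε0 : ∀ N, 0 ≤ ε N := fun N => by have := hdiff N N; simp at this; linarith
  have hc : CauchySeq D := by
    refine Metric.cauchySeq_iff'.2 fun η hη => ?_
    obtain ⟨N, hN⟩ := (hε.eventually (gt_mem_nhds (half_pos hη))).exists_forall_of_atTop
    refine ⟨N, fun n hn => ?_⟩
    rw [Real.dist_eq]
    linarith [hdiff n N, hN n hn, hN N le_rfl]
  obtain ⟨d, hd⟩ := cauchySeq_tendsto_of_complete hc
  refine ⟨d, hd, ?_⟩
  rw [hasDerivAt_iff_isLittleO, isLittleO_iff]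
  intro η hη
  have h1 := hε.eventually (gt_mem_nhds (by positivity : 0 < η / 3))
  have h2 : ∀ᶠ N in atTop, |D N - d| < η / 3 := by
    have := hd.eventually (Metric.ball_mem_nhds d (by positivity : 0 < η / 3))
    simpa [Real.dist_eq] using this
  obtain ⟨N, hN1, hN2⟩ := (h1.and h2).exists
  filter_upwards [happ N (η / 3) (by positivity)] with θ hθ
  simp only [smul_eq_mul, Real.norm_eq_abs]
  have e : f θ - f θ₀ - (θ - θ₀) * d
      = (f θ - f θ₀ - (θ - θ₀) * D N) + (θ - θ₀) * (D N - d) := by ring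
  rw [e]
  refine (abs_add_le _ _).trans ?_
  rw [abs_mul]
  nlinarith [abs_nonneg (θ - θ₀)]

variable {ν : ℕ → Measure 𝓧} [∀ n, IsProbabilityMeasure (ν n)] {q : ℕ → 𝓧 → ℝ}

/-- The derivative of the probability of rejecting within the first `N` stages. -/
noncomputable def truncDeriv (ν : ℕ → Measure 𝓧) (q : ℕ → 𝓧 → ℝ) (ψ φ : Rule 𝓧) (N : ℕ) : ℝ :=
  ∑ i ∈ Finset.range N,
    ∫ x, s ψ (i + 1) x * φ.val (i + 1) x * scoreSum q (i + 1) x ∂law ν (i + 1)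

/-- Split at stage `N`. Each earlier rejection probability is the expectation of a function bounded
by 1 and expands directly. Later rejections contribute nothing to the linear term; their whole
change is put into the error. -/
lemma abs_tsum_rejProb_sub_le {m : ℕ → Measure 𝓧} [∀ n, IsProbabilityMeasure (m n)]
    (hq : ∀ n, Measurable (q n)) (hq2 : ∀ n, MemLp (q n) 2 (ν n))
    {A : ℝ} (hA : ∀ n, ∫ y, |q n y| ∂ν n ≤ A) {h C : ℝ} {ω : ℕ → ℝ} (hC0 : 0 ≤ C)
    (hC : ∀ n, ∀ G : 𝓧 → ℝ, Measurable G → (∀ x, |G x| ≤ 1) →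
      |∫ y, G y ∂m n - ∫ y, G y ∂ν n| ≤ C)
    (hω : ∀ n, ∀ G : 𝓧 → ℝ, Measurable G → ∀ B, (∀ y, |G y| ≤ B) →
      |∫ y, G y ∂m n - ∫ y, G y ∂ν n - h * ∫ y, G y * q n y ∂ν n| ≤ B * ω n)
    (ψ φ : Rule 𝓧) (hψ : FiniteMean ν ψ) (N : ℕ) :
    |∑' n, rejProb m ψ φ (n + 1) - ∑' n, rejProb ν ψ φ (n + 1) - h * truncDeriv ν q ψ φ N|
      ≤ |h| * ∫ x, cont ψ N x * |scoreSum q N x| ∂law ν N + C * ∑' i, surv ν ψ (i + N)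
        + (expansionError A h ω N + ∑ i ∈ Finset.range N, expansionError A h ω (i + 1)) := by
  have hS := (memLp_scoreSum hq2 N).integrable one_le_two
  have hcS : Integrable (fun x => cont ψ N x * |scoreSum q N x|) (law ν N) :=
    hS.abs.bdd_mul (measurable_cont ψ N).aestronglyMeasurable
      (Eventually.of_forall (abs_cont_le_one ψ N))
  have htail : ∀ k, |∑ i ∈ Finset.range k, rejProb m ψ φ (i + N + 1)
      - ∑ i ∈ Finset.range k, rejProb ν ψ φ (i + N + 1)|
      ≤ |h| * ∫ x, cont ψ N x * |scoreSum q N x| ∂law ν N + C * ∑' i, surv ν ψ (i + N)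
        + expansionError A h ω N := by
    intro k
    simp only [add_comm _ N]
    rw [sum_rejProb, sum_rejProb]
    have hGm : Measurable fun x => cont ψ N x * condRej m ψ φ k N x :=
      (measurable_cont ψ N).mul (measurable_condRej m ψ φ k N)
    have hGb : ∀ x, |cont ψ N x * condRej m ψ φ k N x| ≤ 1 := fun x =>
      abs_mul_le_one (abs_cont_le_one ψ N x) (abs_condRej_le_one m ψ φ k N x)
    have b1 := abs_integral_law_sub_le hq hq2 hA hω N hGm hGb
    have b2 : |∫ x, cont ψ N x * condRej m ψ φ k N x * scoreSum q N x ∂law ν N|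
        ≤ ∫ x, cont ψ N x * |scoreSum q N x| ∂law ν N := by
      refine abs_integral_le_integral_abs.trans (integral_mono
        (hS.bdd_mul hGm.aestronglyMeasurable (Eventually.of_forall hGb)).abs hcS fun x => ?_)
      simp only [abs_mul]
      rw [abs_of_nonneg (cont_nonneg ψ N x), mul_assoc]
      refine mul_le_mul_of_nonneg_left ?_ (cont_nonneg ψ N x)
      exact mul_le_of_le_one_left (abs_nonneg _) (abs_condRej_le_one m ψ φ k N x)
    have i1 := integrable_cont_mul ν (ψ := ψ) (measurable_condRej m ψ φ k N)
      (abs_condRej_le_one m ψ φ k N)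
    have i2 := integrable_cont_mul ν (ψ := ψ) (measurable_condRej ν ψ φ k N)
      (abs_condRej_le_one ν ψ φ k N)
    have b3 : |∫ x, cont ψ N x * condRej m ψ φ k N x ∂law ν N
        - ∫ x, cont ψ N x * condRej ν ψ φ k N x ∂law ν N| ≤ C * ∑' i, surv ν ψ (N + i) := by
      rw [← integral_sub i1 i2]
      refine abs_integral_le_integral_abs.trans ?_
      have e : ∀ x, |cont ψ N x * condRej m ψ φ k N x - cont ψ N x * condRej ν ψ φ k N x|
          = cont ψ N x * |condRej m ψ φ k N x - condRej ν ψ φ k N x| := fun x => by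
        rw [← mul_sub, abs_mul, abs_of_nonneg (cont_nonneg ψ N x)]
      simp_rw [e]
      refine (integral_cont_mul_abs_condRej_sub_le m ν hC ψ φ k N).trans ?_
      refine mul_le_mul_of_nonneg_left ?_ hC0
      simp only [add_comm N]
      exact ((summable_nat_add_iff N).2 hψ.summable_surv).sum_le_tsum _
        fun i _ => surv_nonneg ν ψ _
    have b4 := mul_le_mul_of_nonneg_left b2 (abs_nonneg h)
    rw [← abs_mul] at b4
    set a := ∫ x, cont ψ N x * condRej m ψ φ k N x ∂law m N
    set b := ∫ x, cont ψ N x * condRej m ψ φ k N x ∂law ν N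
    set c := ∫ x, cont ψ N x * condRej ν ψ φ k N x ∂law ν N
    set d := h * ∫ x, cont ψ N x * condRej m ψ φ k N x * scoreSum q N x ∂law ν N
    have hsplit : a - c = (a - b - d) + d + (b - c) := by ring
    rw [hsplit]
    refine (abs_add_three _ _ _).trans ?_
    linarith
  have hsm := (summable_nat_add_iff N).2 (summable_rejProb m ψ φ)
  have hsν := (summable_nat_add_iff N).2 (summable_rejProb ν ψ φ)
  -- The tail bound does not depend on the number `k` of later stages, so it survives k → ∞.
  have htail' := le_of_tendsto
    ((hsm.hasSum.tendsto_sum_nat.sub hsν.hasSum.tendsto_sum_nat).abs)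
    (Eventually.of_forall htail)
  have hhead : |∑ i ∈ Finset.range N, rejProb m ψ φ (i + 1)
      - ∑ i ∈ Finset.range N, rejProb ν ψ φ (i + 1) - h * truncDeriv ν q ψ φ N|
      ≤ ∑ i ∈ Finset.range N, expansionError A h ω (i + 1) := by
    rw [truncDeriv, Finset.mul_sum, ← Finset.sum_sub_distrib, ← Finset.sum_sub_distrib]
    refine (Finset.abs_sum_le_sum_abs _ _).trans (Finset.sum_le_sum fun i _ => ?_)
    have := abs_integral_law_sub_le hq hq2 hA hω (i + 1) (measurable_s_mul ψ φ i)
      (abs_s_mul_le_one ψ φ i)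
    rwa [one_mul] at this
  rw [← (summable_rejProb m ψ φ).sum_add_tsum_nat_add N,
    ← (summable_rejProb ν ψ φ).sum_add_tsum_nat_add N]
  set a := ∑ i ∈ Finset.range N, rejProb m ψ φ (i + 1)
  set b := ∑ i ∈ Finset.range N, rejProb ν ψ φ (i + 1)
  set a' := ∑' i, rejProb m ψ φ (i + N + 1)
  set b' := ∑' i, rejProb ν ψ φ (i + N + 1)
  have hsplit : a + a' - (b + b') - h * truncDeriv ν q ψ φ N
      = (a - b - h * truncDeriv ν q ψ φ N) + (a' - b') := by ring
  rw [hsplit]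
  refine (abs_add_le _ _).trans ?_
  linarith

/-- The power function of a test with a finite mean sample number under `θ₀` is differentiable at
`θ₀`. -/
theorem exists_hasDerivAt_tsum_rejProb {m : ℝ → ℕ → Measure 𝓧} {θ₀ : ℝ} (hm₀ : m θ₀ = ν)
    (hm : ∀ᶠ θ in 𝓝 θ₀, ∀ n, IsProbabilityMeasure (m θ n))
    (hq : ∀ n, Measurable (q n)) (hq2 : ∀ n, MemLp (q n) 2 (ν n))
    (hq0 : ∀ n, ∫ y, q n y ∂ν n = 0) {σ2 : ℝ} (hσ : ∀ n, ∫ y, q n y ^ 2 ∂ν n ≤ σ2)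
    {A : ℝ} (hA : ∀ n, ∫ y, |q n y| ∂ν n ≤ A) {C : ℝ} (hC0 : 0 ≤ C)
    (hC : ∀ᶠ θ in 𝓝 θ₀, ∀ n, ∀ G : 𝓧 → ℝ, Measurable G → (∀ x, |G x| ≤ 1) →
      |∫ y, G y ∂m θ n - ∫ y, G y ∂ν n| ≤ C * |θ - θ₀|)
    {ω : ℝ → ℕ → ℝ} (hω0 : ∀ n, (fun θ => ω θ n) =o[𝓝 θ₀] fun θ => θ - θ₀)
    (hω : ∀ᶠ θ in 𝓝 θ₀, ∀ n, ∀ G : 𝓧 → ℝ, Measurable G → ∀ B, (∀ y, |G y| ≤ B) →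
      |∫ y, G y ∂m θ n - ∫ y, G y ∂ν n - (θ - θ₀) * ∫ y, G y * q n y ∂ν n| ≤ B * ω θ n)
    (ψ φ : Rule 𝓧) (hψ : FiniteMean ν ψ) :
    ∃ d, Tendsto (truncDeriv ν q ψ φ) atTop (𝓝 d) ∧
      HasDerivAt (fun θ => ∑' n, rejProb (m θ) ψ φ (n + 1)) d θ₀ := by
  have hε : Tendsto (fun N => ∫ x, cont ψ N x * |scoreSum q N x| ∂law ν N
      + C * ∑' i, surv ν ψ (i + N)) atTop (𝓝 0) := by
    simpa using (hψ.tendsto_cont_mul_abs_scoreSum hq2 hq0 hσ).add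
      ((tendsto_sum_nat_add (surv ν ψ)).const_mul C)
  refine exists_hasDerivAt_of_approx hε fun N =>
    ⟨fun θ => expansionError A (θ - θ₀) (ω θ) N
      + ∑ i ∈ Finset.range N, expansionError A (θ - θ₀) (ω θ) (i + 1),
      (isLittleO_expansionError hω0 N).add
        (IsLittleO.fun_sum fun i _ => isLittleO_expansionError hω0 (i + 1)), ?_⟩
  filter_upwards [hm, hC, hω] with θ h1 h2 h3
  have := abs_tsum_rejProb_sub_le hq hq2 hA (mul_nonneg hC0 (abs_nonneg (θ - θ₀))) h2 h3 ψ φ hψ N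
  rw [hm₀]
  linarith

end Differentiability

/-! ### A function below all truncated values. -/

section Minorant

/-- A smooth minorant of `g` with bounded curvature. -/
noncomputable def minorant (a z : ℝ) : ℝ := (z - √(z ^ 2 + a ^ 2)) / 2

lemma minorant_le_g (a z : ℝ) : minorant a z ≤ g z := by
  have h : |z| ≤ √(z ^ 2 + a ^ 2) := Real.abs_le_sqrt (by nlinarith [sq_nonneg a])
  rw [minorant, g, le_min_iff]
  constructor
  · linarith [le_abs_self z]
  · linarith [neg_abs_le z]

lemma neg_le_minorant {a : ℝ} (ha : 0 < a) (z : ℝ) : -(|z| + a) ≤ minorant a z := by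
  have h : √(z ^ 2 + a ^ 2) ≤ |z| + a := by
    rw [Real.sqrt_le_left (by positivity)]
    nlinarith [abs_nonneg z, sq_abs z]
  rw [minorant]
  linarith [neg_abs_le z]

lemma continuous_minorant (a : ℝ) : Continuous (minorant a) := by
  unfold minorant; fun_prop

/-- κ is the derivative of the minorant at `z`. With S and T the square roots at z and z − q, the
inequality T ≤ (S² + T²)/(2S) leaves a quadratic error q²/(4S), and S ≥ a. -/
lemma exists_minorant_sub_ge {a : ℝ} (ha : 0 < a) (z : ℝ) :
    ∃ κ, ∀ q, minorant a z - κ * q - q ^ 2 / (4 * a) ≤ minorant a (z - q) := by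
  set S := √(z ^ 2 + a ^ 2) with hS
  have hSsq : S ^ 2 = z ^ 2 + a ^ 2 := Real.sq_sqrt (by positivity)
  have haS : a ≤ S := Real.le_sqrt_of_sq_le (by nlinarith [sq_nonneg z])
  have hS0 : 0 < S := ha.trans_le haS
  refine ⟨(1 - z / S) / 2, fun q => ?_⟩
  set T := √((z - q) ^ 2 + a ^ 2) with hT
  have hTsq : T ^ 2 = (z - q) ^ 2 + a ^ 2 := Real.sq_sqrt (by positivity)
  have h1 : T ≤ S + (q ^ 2 - 2 * z * q) / (2 * S) := by
    have : S + (q ^ 2 - 2 * z * q) / (2 * S) = (S ^ 2 + T ^ 2) / (2 * S) := by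
      field_simp
      rw [hTsq, hSsq]; ring
    rw [this, le_div_iff₀ (by positivity)]
    nlinarith [sq_nonneg (S - T)]
  have h2 : q ^ 2 / (4 * S) ≤ q ^ 2 / (4 * a) := by gcongr
  have h3 : (q ^ 2 - 2 * z * q) / (2 * S) = 2 * (q ^ 2 / (4 * S)) - z / S * q := by
    field_simp; ring
  rw [minorant, minorant, ← hS, ← hT]
  rw [h3] at h1
  linarith

end Minorant

/-! ### Backward induction and its limit. -/

lemma lipschitzWith_g : LipschitzWith 1 g :=
  LipschitzWith.id.const_min 0

lemma g_nonpos (z : ℝ) : g z ≤ 0 := min_le_left _ _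

lemma abs_le_of_lipschitzWith {V : ℝ → ℝ} (hV : LipschitzWith 1 V) (z : ℝ) :
    |V z| ≤ |V 0| + |z| := by
  have h := hV.dist_le_mul z 0
  simp only [Real.dist_eq, NNReal.coe_one, one_mul, sub_zero] at h
  have := abs_add_le (V z - V 0) (V 0)
  rw [sub_add_cancel] at this
  linarith

lemma integrable_comp_of_lipschitzWith {α : Type*} [MeasurableSpace α] {m : Measure α}
    [IsFiniteMeasure m] {V : ℝ → ℝ} (hV : LipschitzWith 1 V) {W : α → ℝ} (hW : Integrable W m) :
    Integrable (fun x => V (W x)) m := by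
  refine ((integrable_const |V 0|).add hW.abs).mono'
    (hV.continuous.comp_aestronglyMeasurable hW.1) (Eventually.of_forall fun x => ?_)
  exact abs_le_of_lipschitzWith hV (W x)

/-- Averaging over shifts preserves the Lipschitz constant 1. All value functions inherit it from
`g`, whence their measurability and linear growth, and so their integrability. -/
lemma lipschitzWith_integral_sub {α : Type*} [MeasurableSpace α] {m : Measure α}
    [IsProbabilityMeasure m] {V : ℝ → ℝ} (hV : LipschitzWith 1 V) {q : α → ℝ}
    (hq : Integrable q m) : LipschitzWith 1 fun z => ∫ y, V (z - q y) ∂m := by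
  have hi : ∀ z, Integrable (fun y => V (z - q y)) m := fun z =>
    integrable_comp_of_lipschitzWith hV ((integrable_const z).sub hq)
  refine LipschitzWith.of_dist_le_mul fun z w => ?_
  rw [Real.dist_eq, ← integral_sub (hi z) (hi w)]
  have := norm_integral_le_of_norm_le_const (μ := m)
    (f := fun y => V (z - q y) - V (w - q y)) (C := dist z w) (Eventually.of_forall fun y => by
      have := hV.dist_le_mul (z - q y) (w - q y)
      simpa [Real.dist_eq] using this)
  simpa using this

section Values

variable (ν : ℕ → Measure 𝓧) (q : ℕ → 𝓧 → ℝ) (c : ℝ)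

/-- The optimal value at stage `n` with at most `k` further observations. -/
noncomputable def truncValue : (k n : ℕ) → ℝ → ℝ
  | 0, _, z => g z
  | k + 1, n, z => min (g z) (c + ∫ y, truncValue k (n + 1) (z - q n y) ∂ν n)

/-- The optimal value of taking at least one more observation after stage `n`, and at most `k + 1`
more, without the cost of the first. -/
noncomputable def truncContValue (k n : ℕ) (z : ℝ) : ℝ :=
  ∫ y, truncValue ν q c k (n + 1) (z - q n y) ∂ν n

/-- The limit of `truncValue`. -/
noncomputable def value (n : ℕ) (z : ℝ) : ℝ := ⨅ k, truncValue ν q c k n z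

/-- The limit of `truncContValue`. -/
noncomputable def contValue (n : ℕ) (z : ℝ) : ℝ := ⨅ k, truncContValue ν q c k n z

lemma truncValue_succ (k n : ℕ) (z : ℝ) :
    truncValue ν q c (k + 1) n z = min (g z) (c + truncContValue ν q c k n z) := rfl

lemma truncValue_le_g (k n : ℕ) (z : ℝ) : truncValue ν q c k n z ≤ g z := by
  cases k with
  | zero => exact le_rfl
  | succ k => exact min_le_left _ _

variable {q} [∀ n, IsProbabilityMeasure (ν n)]

lemma lipschitzWith_truncValue (hq : ∀ n, Integrable (q n) (ν n)) (k n : ℕ) :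
    LipschitzWith 1 (truncValue ν q c k n) := by
  induction k generalizing n with
  | zero => exact lipschitzWith_g
  | succ k ih =>
    have h1 : LipschitzWith 1 fun z => c + ∫ y, truncValue ν q c k (n + 1) (z - q n y) ∂ν n := by
      have := lipschitzWith_integral_sub (ih (n + 1)) (hq n)
      refine LipschitzWith.of_dist_le_mul fun z w => ?_
      rw [dist_add_left]
      exact this.dist_le_mul z w
    have h2 := lipschitzWith_g.min h1
    rwa [max_self] at h2

lemma integrable_truncValue (hq : ∀ n, Integrable (q n) (ν n)) (k n : ℕ) (z : ℝ) :
    Integrable (fun y => truncValue ν q c k (n + 1) (z - q n y)) (ν n) :=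
  integrable_comp_of_lipschitzWith (lipschitzWith_truncValue ν c hq k (n + 1))
    ((integrable_const z).sub (hq n))

lemma lipschitzWith_truncContValue (hq : ∀ n, Integrable (q n) (ν n)) (k n : ℕ) :
    LipschitzWith 1 (truncContValue ν q c k n) :=
  lipschitzWith_integral_sub (lipschitzWith_truncValue ν c hq k (n + 1)) (hq n)

lemma truncValue_succ_le (hq : ∀ n, Integrable (q n) (ν n)) (k n : ℕ) (z : ℝ) :
    truncValue ν q c (k + 1) n z ≤ truncValue ν q c k n z := by
  induction k generalizing n z with
  | zero => exact min_le_left _ _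
  | succ k ih =>
    rw [truncValue_succ, truncValue_succ]
    refine min_le_min_left _ (add_le_add_right ?_ c)
    exact integral_mono (integrable_truncValue ν c hq _ n z) (integrable_truncValue ν c hq _ n z)
      fun y => ih (n + 1) _

lemma antitone_truncValue (hq : ∀ n, Integrable (q n) (ν n)) (n : ℕ) (z : ℝ) :
    Antitone fun k => truncValue ν q c k n z :=
  antitone_nat_of_succ_le fun k => truncValue_succ_le ν c hq k n z

lemma antitone_truncContValue (hq : ∀ n, Integrable (q n) (ν n)) (n : ℕ) (z : ℝ) :
    Antitone fun k => truncContValue ν q c k n z :=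
  antitone_nat_of_succ_le fun k =>
    integral_mono (integrable_truncValue ν c hq _ n z) (integrable_truncValue ν c hq _ n z)
      fun _ => truncValue_succ_le ν c hq k (n + 1) _

omit [∀ n, IsProbabilityMeasure (ν n)] in
lemma truncContValue_nonpos (k n : ℕ) (z : ℝ) : truncContValue ν q c k n z ≤ 0 :=
  integral_nonpos fun _ => (truncValue_le_g ν q c k (n + 1) _).trans (g_nonpos _)

variable {ν} {c} {a σ2 : ℝ}

/-- The linear term averages to zero, and the quadratic one costs at most σ²/(4a) ≤ c. So paying `c`
per observation compensates the loss in the minorant. -/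
lemma minorant_sub_le_integral (ha : 0 < a) (hσa : σ2 ≤ 4 * a * c)
    (hq2 : ∀ n, MemLp (q n) 2 (ν n)) (hq0 : ∀ n, ∫ y, q n y ∂ν n = 0)
    (hσ : ∀ n, ∫ y, q n y ^ 2 ∂ν n ≤ σ2) (n : ℕ) (z : ℝ)
    (hm : Integrable (fun y => minorant a (z - q n y)) (ν n)) :
    minorant a z - c ≤ ∫ y, minorant a (z - q n y) ∂ν n := by
  obtain ⟨κ, hκ⟩ := exists_minorant_sub_ge ha z
  have hi := (hq2 n).integrable one_le_two
  have i1 : Integrable (fun y => minorant a z - κ * q n y) (ν n) :=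
    (integrable_const _).sub (hi.const_mul κ)
  have i2 : Integrable (fun y => q n y ^ 2 / (4 * a)) (ν n) := (hq2 n).integrable_sq.div_const _
  have h1 : (∫ y, q n y ^ 2 ∂ν n) / (4 * a) ≤ c := by
    rw [div_le_iff₀ (by positivity)]
    linarith [hσ n]
  calc minorant a z - c
      ≤ minorant a z - κ * ∫ y, q n y ∂ν n - (∫ y, q n y ^ 2 ∂ν n) / (4 * a) := by
        rw [hq0]; linarith
    _ = ∫ y, (minorant a z - κ * q n y - q n y ^ 2 / (4 * a)) ∂ν n := by
        rw [integral_sub i1 i2, integral_sub (integrable_const _) (hi.const_mul κ),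
          integral_const_mul, integral_div]
        simp
    _ ≤ _ := integral_mono (i1.sub i2) hm fun y => hκ (q n y)

lemma integrable_minorant (ha : 0 < a) (hq : ∀ n, Integrable (q n) (ν n)) (n : ℕ) (z : ℝ) :
    Integrable (fun y => minorant a (z - q n y)) (ν n) := by
  have hs : Integrable (fun y => z - q n y) (ν n) := (integrable_const z).sub (hq n)
  refine (hs.abs.add (integrable_const a)).mono'
    ((continuous_minorant a).comp_aestronglyMeasurable hs.1) (Eventually.of_forall fun y => ?_)
  have h1 := neg_le_minorant ha (z - q n y)
  have h2 := (minorant_le_g a (z - q n y)).trans (g_nonpos _)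
  rw [Real.norm_eq_abs, abs_of_nonpos h2]
  simp only [Pi.add_apply]
  linarith

lemma minorant_le_truncValue (ha : 0 < a) (hσa : σ2 ≤ 4 * a * c)
    (hq2 : ∀ n, MemLp (q n) 2 (ν n)) (hq0 : ∀ n, ∫ y, q n y ∂ν n = 0)
    (hσ : ∀ n, ∫ y, q n y ^ 2 ∂ν n ≤ σ2) (k n : ℕ) (z : ℝ) :
    minorant a z ≤ truncValue ν q c k n z := by
  have hq : ∀ n, Integrable (q n) (ν n) := fun n => (hq2 n).integrable one_le_two
  induction k generalizing n z with
  | zero => exact minorant_le_g a z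
  | succ k ih =>
    refine le_min (minorant_le_g a z) ?_
    have hm := integrable_minorant ha hq n z
    have h1 := minorant_sub_le_integral ha hσa hq2 hq0 hσ n z hm
    have h2 := integral_mono hm (integrable_truncValue ν c hq k n z) fun y => ih (n + 1) _
    linarith

lemma minorant_sub_le_truncContValue (ha : 0 < a) (hσa : σ2 ≤ 4 * a * c)
    (hq2 : ∀ n, MemLp (q n) 2 (ν n)) (hq0 : ∀ n, ∫ y, q n y ∂ν n = 0)
    (hσ : ∀ n, ∫ y, q n y ^ 2 ∂ν n ≤ σ2) (k n : ℕ) (z : ℝ) :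
    minorant a z - c ≤ truncContValue ν q c k n z := by
  have hq : ∀ n, Integrable (q n) (ν n) := fun n => (hq2 n).integrable one_le_two
  have hm := integrable_minorant ha hq n z
  exact (minorant_sub_le_integral ha hσa hq2 hq0 hσ n z hm).trans
    (integral_mono hm (integrable_truncValue ν c hq k n z) fun y =>
      minorant_le_truncValue ha hσa hq2 hq0 hσ k (n + 1) _)

/-- The properties of the optimal values on which the optimality of the test rests. -/
structure IsOptimalValue (ν : ℕ → Measure 𝓧) (q : ℕ → 𝓧 → ℝ) (c K : ℝ) (v r : ℕ → ℝ → ℝ) :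
    Prop where
  lipschitz_v : ∀ n, LipschitzWith 1 (v n)
  lipschitz_r : ∀ n, LipschitzWith 1 (r n)
  v_eq : ∀ n z, v n z = min (g z) (c + r n z)
  r_eq : ∀ n z, r n z = ∫ y, v (n + 1) (z - q n y) ∂ν n
  abs_r_le : ∀ n z, |r n z| ≤ |z| + K

/-- More permitted observations lower the value, and the minorant bounds it below. Without this
bound the real infimum would be a default value. -/
lemma tendsto_truncContValue (ha : 0 < a) (hσa : σ2 ≤ 4 * a * c)
    (hq2 : ∀ n, MemLp (q n) 2 (ν n)) (hq0 : ∀ n, ∫ y, q n y ∂ν n = 0)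
    (hσ : ∀ n, ∫ y, q n y ^ 2 ∂ν n ≤ σ2) (n : ℕ) (z : ℝ) :
    Tendsto (fun k => truncContValue ν q c k n z) atTop (𝓝 (contValue ν q c n z)) :=
  tendsto_atTop_ciInf (antitone_truncContValue ν c (fun n => (hq2 n).integrable one_le_two) n z)
    ⟨minorant a z - c, by
      rintro _ ⟨k, rfl⟩; exact minorant_sub_le_truncContValue ha hσa hq2 hq0 hσ k n z⟩

lemma tendsto_truncValue (ha : 0 < a) (hσa : σ2 ≤ 4 * a * c)
    (hq2 : ∀ n, MemLp (q n) 2 (ν n)) (hq0 : ∀ n, ∫ y, q n y ∂ν n = 0)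
    (hσ : ∀ n, ∫ y, q n y ^ 2 ∂ν n ≤ σ2) (n : ℕ) (z : ℝ) :
    Tendsto (fun k => truncValue ν q c k n z) atTop (𝓝 (value ν q c n z)) :=
  tendsto_atTop_ciInf (antitone_truncValue ν c (fun n => (hq2 n).integrable one_le_two) n z)
    ⟨minorant a z, by
      rintro _ ⟨k, rfl⟩; exact minorant_le_truncValue ha hσa hq2 hq0 hσ k n z⟩

lemma lipschitzWith_of_tendsto {F : ℕ → ℝ → ℝ} {f : ℝ → ℝ} (hF : ∀ k, LipschitzWith 1 (F k))
    (h : ∀ z, Tendsto (fun k => F k z) atTop (𝓝 (f z))) : LipschitzWith 1 f :=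
  LipschitzWith.of_dist_le_mul fun z w =>
    le_of_tendsto ((h z).dist (h w)) (Eventually.of_forall fun k => (hF k).dist_le_mul z w)

lemma isOptimalValue (ha : 0 < a) (hσa : σ2 ≤ 4 * a * c)
    (hq2 : ∀ n, MemLp (q n) 2 (ν n)) (hq0 : ∀ n, ∫ y, q n y ∂ν n = 0)
    (hσ : ∀ n, ∫ y, q n y ^ 2 ∂ν n ≤ σ2) :
    IsOptimalValue ν q c (a + c) (value ν q c) (contValue ν q c) := by
  have hq : ∀ n, Integrable (q n) (ν n) := fun n => (hq2 n).integrable one_le_two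
  have hv := tendsto_truncValue ha hσa hq2 hq0 hσ
  have hr := tendsto_truncContValue ha hσa hq2 hq0 hσ
  refine ⟨fun n => lipschitzWith_of_tendsto (fun k => lipschitzWith_truncValue ν c hq k n) (hv n),
    fun n => lipschitzWith_of_tendsto (fun k => lipschitzWith_truncContValue ν c hq k n) (hr n),
    fun n z => ?_, fun n z => ?_, fun n z => ?_⟩
  · exact tendsto_nhds_unique ((tendsto_add_atTop_iff_nat 1).2 (hv n z))
      (tendsto_const_nhds.min ((hr n z).const_add c))
  -- Dominated convergence: every truncated value lies between the minorant and 0.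
  · refine tendsto_nhds_unique (hr n z) ?_
    refine tendsto_integral_of_dominated_convergence (fun y => |z - q n y| + a)
      (fun k => (integrable_truncValue ν c hq k n z).1)
      (((integrable_const z).sub (hq n)).abs.add (integrable_const a)) (fun k => ?_)
      (Eventually.of_forall fun y => hv (n + 1) _)
    refine Eventually.of_forall fun y => ?_
    have h1 := (truncValue_le_g ν q c k (n + 1) (z - q n y)).trans (g_nonpos _)
    have h2 := minorant_le_truncValue ha hσa hq2 hq0 hσ k (n + 1) (z - q n y)
    have h3 := neg_le_minorant ha (z - q n y)
    rw [Real.norm_eq_abs, abs_of_nonpos h1]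
    linarith
  · have h1 : contValue ν q c n z ≤ 0 :=
      le_of_tendsto (hr n z) (Eventually.of_forall fun k => truncContValue_nonpos ν c k n z)
    have h2 := ge_of_tendsto (hr n z) (Eventually.of_forall fun k =>
      minorant_sub_le_truncContValue ha hσa hq2 hq0 hσ k n z)
    have h3 := neg_le_minorant ha z
    rw [abs_of_nonpos h1]
    linarith

end Values

/-! ### The Lagrangian as a minimum plus losses. -/

section Lagrangian

/-- The loss, relative to the optimum, by the stopping rule at stage `n`. -/
noncomputable def stopGap (q : ℕ → 𝓧 → ℝ) (b c : ℝ) (v r : ℕ → ℝ → ℝ) (ψ : Rule 𝓧) (n : ℕ)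
    (x : Fin n → 𝓧) : ℝ :=
  ψ.val n x * g (b - scoreSum q n x) + (1 - ψ.val n x) * (c + r n (b - scoreSum q n x))
    - v n (b - scoreSum q n x)

/-- The loss, relative to the optimum, by the decision rule at stage `n`. -/
noncomputable def decGap (q : ℕ → 𝓧 → ℝ) (b : ℝ) (φ : Rule 𝓧) (n : ℕ) (x : Fin n → 𝓧) : ℝ :=
  φ.val n x * (b - scoreSum q n x) - g (b - scoreSum q n x)

/-- The total loss at stage `n + 1`. -/
noncomputable def lossGap (q : ℕ → 𝓧 → ℝ) (b c : ℝ) (v r : ℕ → ℝ → ℝ) (ψ φ : Rule 𝓧) (n : ℕ)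
    (x : Fin (n + 1) → 𝓧) : ℝ :=
  t ψ (n + 1) x * stopGap q b c v r ψ (n + 1) x + s ψ (n + 1) x * decGap q b φ (n + 1) x

variable {ν : ℕ → Measure 𝓧} [∀ n, IsProbabilityMeasure (ν n)] {q : ℕ → 𝓧 → ℝ} {b c K : ℝ}
  {v r : ℕ → ℝ → ℝ}

omit [∀ n, IsProbabilityMeasure (ν n)] in
lemma IsOptimalValue.stopGap_nonneg (hv : IsOptimalValue ν q c K v r) (ψ : Rule 𝓧) (n : ℕ)
    (x : Fin n → 𝓧) : 0 ≤ stopGap q b c v r ψ n x := by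
  rw [stopGap, hv.v_eq]
  set w := b - scoreSum q n x
  have h1 := mul_le_mul_of_nonneg_left (min_le_left (g w) (c + r n w)) (ψ.nonneg n x)
  have h2 := mul_le_mul_of_nonneg_left (min_le_right (g w) (c + r n w))
    (sub_nonneg.2 (ψ.le_one n x))
  linarith

lemma decGap_nonneg (φ : Rule 𝓧) (n : ℕ) (x : Fin n → 𝓧) : 0 ≤ decGap q b φ n x := by
  rw [decGap, g]
  set w := b - scoreSum q n x
  have h1 := mul_le_mul_of_nonneg_left (min_le_right 0 w) (φ.nonneg n x)
  have h2 := mul_le_mul_of_nonneg_left (min_le_left 0 w) (sub_nonneg.2 (φ.le_one n x))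
  linarith

lemma t_succ_nonneg (ψ : Rule 𝓧) (n : ℕ) (x : Fin (n + 1) → 𝓧) : 0 ≤ t ψ (n + 1) x := by
  rw [t_succ]; exact cont_nonneg _ _ _

omit [∀ n, IsProbabilityMeasure (ν n)] in
lemma IsOptimalValue.lossGap_nonneg (hv : IsOptimalValue ν q c K v r) (ψ φ : Rule 𝓧) (n : ℕ)
    (x : Fin (n + 1) → 𝓧) : 0 ≤ lossGap q b c v r ψ φ n x :=
  add_nonneg (mul_nonneg (t_succ_nonneg ψ n x) (hv.stopGap_nonneg ψ _ x))
    (mul_nonneg (s_succ_nonneg ψ n x) (decGap_nonneg φ _ x))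

lemma integrable_lipschitz_score (hq2 : ∀ n, MemLp (q n) 2 (ν n)) {V : ℝ → ℝ}
    (hV : LipschitzWith 1 V) (b : ℝ) (n : ℕ) :
    Integrable (fun x => V (b - scoreSum q n x)) (law ν n) :=
  integrable_comp_of_lipschitzWith hV
    ((integrable_const b).sub ((memLp_scoreSum hq2 n).integrable one_le_two))

/-- One step of the decomposition of the Lagrangian. -/
lemma IsOptimalValue.lagrangian_step (hv : IsOptimalValue ν q c K v r)
    (hq2 : ∀ n, MemLp (q n) 2 (ν n)) (ψ φ : Rule 𝓧) (N : ℕ) :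
    Integrable (lossGap q b c v r ψ φ N) (law ν (N + 1)) ∧
    c * (((N + 1 : ℕ) : ℝ) * stopMass ν ψ (N + 1)) + b * rejProb ν ψ φ (N + 1)
      - ∫ x, s ψ (N + 1) x * φ.val (N + 1) x * scoreSum q (N + 1) x ∂law ν (N + 1)
      + ∫ x, cont ψ (N + 1) x * (c * ((N + 1 + 1 : ℕ) : ℝ) + r (N + 1) (b - scoreSum q (N + 1) x))
          ∂law ν (N + 1)
      = ∫ x, cont ψ N x * (c * ((N + 1 : ℕ) : ℝ) + r N (b - scoreSum q N x)) ∂law ν N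
        + ∫ x, lossGap q b c v r ψ φ N x ∂law ν (N + 1) := by
  have mc : Measurable fun x : Fin (N + 1) → 𝓧 => cont ψ N (pop x) :=
    (measurable_cont ψ N).comp (measurable_pop N)
  have bc : ∀ x : Fin (N + 1) → 𝓧, |cont ψ N (pop x)| ≤ 1 := fun x => abs_cont_le_one ψ N _
  have hS := (memLp_scoreSum hq2 (N + 1)).integrable one_le_two
  have i1 : Integrable (fun x => s ψ (N + 1) x) (law ν (N + 1)) := integrable_s_succ ν ψ N
  have i2 : Integrable (fun x => s ψ (N + 1) x * φ.val (N + 1) x) (law ν (N + 1)) :=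
    integrable_of_bounded (measurable_s_mul ψ φ N) (abs_s_mul_le_one ψ φ N)
  have i3 : Integrable (fun x => s ψ (N + 1) x * φ.val (N + 1) x * scoreSum q (N + 1) x)
      (law ν (N + 1)) :=
    hS.bdd_mul (measurable_s_mul ψ φ N).aestronglyMeasurable
      (Eventually.of_forall (abs_s_mul_le_one ψ φ N))
  have i4 : ∀ V, LipschitzWith 1 V → Integrable (fun x => V (b - scoreSum q (N + 1) x))
      (law ν (N + 1)) := fun V hV => integrable_lipschitz_score hq2 hV b (N + 1)
  have i5 : Integrable (fun x => cont ψ (N + 1) x * (c * ((N + 1 + 1 : ℕ) : ℝ)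
      + r (N + 1) (b - scoreSum q (N + 1) x))) (law ν (N + 1)) :=
    ((integrable_const _).add (i4 _ (hv.lipschitz_r _))).bdd_mul
      (measurable_cont ψ (N + 1)).aestronglyMeasurable
      (Eventually.of_forall (abs_cont_le_one ψ (N + 1)))
  have i6 : Integrable (fun x => cont ψ N (pop x) * (c * ((N + 1 : ℕ) : ℝ)
      + v (N + 1) (b - scoreSum q (N + 1) x))) (law ν (N + 1)) :=
    ((integrable_const _).add (i4 _ (hv.lipschitz_v _))).bdd_mul mc.aestronglyMeasurable
      (Eventually.of_forall bc)
  -- Before an observation the expected cost-to-go on {τ > N} is c(N + 1) + r_N; once it is made,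
  -- this becomes c(N + 1) + v_{N+1}, by integrating out the last observation.
  have e6 : ∫ x, cont ψ N x * (c * ((N + 1 : ℕ) : ℝ) + r N (b - scoreSum q N x)) ∂law ν N
      = ∫ x, cont ψ N (pop x) * (c * ((N + 1 : ℕ) : ℝ)
        + v (N + 1) (b - scoreSum q (N + 1) x)) ∂law ν (N + 1) := by
    rw [integral_law_succ i6]
    refine integral_congr_ae (Eventually.of_forall fun x => ?_)
    have hvi : Integrable (fun y => v (N + 1) (b - scoreSum q N x - q N y)) (ν N) :=
      integrable_comp_of_lipschitzWith (hv.lipschitz_v _)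
        ((integrable_const _).sub ((hq2 N).integrable one_le_two))
    simp only [pop_push, scoreSum_push, ← sub_sub]
    rw [integral_const_mul, integral_add (integrable_const _) hvi, ← hv.r_eq]
    simp
  have j1 : Integrable (fun x => c * ((N + 1 : ℕ) : ℝ) * s ψ (N + 1) x
      + b * (s ψ (N + 1) x * φ.val (N + 1) x)) (law ν (N + 1)) :=
    (i1.const_mul _).add (i2.const_mul _)
  have j2 := j1.sub i3
  have j3 := j2.add i5
  -- Pointwise bookkeeping: the loss is the actual cost of stopping or going on, less the optimal
  -- value v_{N+1}, all weighted by the probability of having reached the stage.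
  have hpt : ∀ x, lossGap q b c v r ψ φ N x
      = (c * ((N + 1 : ℕ) : ℝ) * s ψ (N + 1) x + b * (s ψ (N + 1) x * φ.val (N + 1) x)
        - s ψ (N + 1) x * φ.val (N + 1) x * scoreSum q (N + 1) x
        + cont ψ (N + 1) x * (c * ((N + 1 + 1 : ℕ) : ℝ)
          + r (N + 1) (b - scoreSum q (N + 1) x)))
        - cont ψ N (pop x) * (c * ((N + 1 : ℕ) : ℝ)
          + v (N + 1) (b - scoreSum q (N + 1) x)) := by
    intro x
    rw [lossGap, stopGap, decGap, t_succ, s_succ, cont]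
    push_cast
    ring
  refine ⟨(j3.sub i6).congr (Eventually.of_forall fun x => (hpt x).symm), ?_⟩
  simp_rw [hpt]
  rw [e6, integral_sub (by exact j3) i6, integral_add (by exact j2) i5, integral_sub j1 i3,
    integral_add (i1.const_mul _) (i2.const_mul _), integral_const_mul, integral_const_mul,
    stopMass, rejProb]
  ring

/-- The one-step identities telescope. What remains at stage `N` is the cost-to-go on {τ > N}, which
at stage 0 is c + r₀(b). -/
lemma IsOptimalValue.lagrangian_sum (hv : IsOptimalValue ν q c K v r)
    (hq2 : ∀ n, MemLp (q n) 2 (ν n)) (ψ φ : Rule 𝓧) (N : ℕ) :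
    ∑ i ∈ Finset.range N, ∫ x, lossGap q b c v r ψ φ i x ∂law ν (i + 1)
      = c * ∑ i ∈ Finset.range N, ((i + 1 : ℕ) : ℝ) * stopMass ν ψ (i + 1)
        + b * ∑ i ∈ Finset.range N, rejProb ν ψ φ (i + 1) - truncDeriv ν q ψ φ N
        + ∫ x, cont ψ N x * (c * ((N + 1 : ℕ) : ℝ) + r N (b - scoreSum q N x)) ∂law ν N
        - (c + r 0 b) := by
  induction N with
  | zero => simp [truncDeriv, cont, scoreSum]
  | succ N ih =>
    have := (hv.lagrangian_step (b := b) hq2 ψ φ N).2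
    simp only [truncDeriv, Finset.sum_range_succ] at ih ⊢
    linarith

/-- The Lagrangian of a test exceeds the optimum by the total of its losses. -/
theorem IsOptimalValue.hasSum_lossGap (hv : IsOptimalValue ν q c K v r)
    (hq2 : ∀ n, MemLp (q n) 2 (ν n)) (hq0 : ∀ n, ∫ y, q n y ∂ν n = 0) {σ2 : ℝ}
    (hσ : ∀ n, ∫ y, q n y ^ 2 ∂ν n ≤ σ2) (ψ φ : Rule 𝓧) (hψ : FiniteMean ν ψ) {d : ℝ}
    (hd : Tendsto (truncDeriv ν q ψ φ) atTop (𝓝 d)) :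
    HasSum (fun n => ∫ x, lossGap q b c v r ψ φ n x ∂law ν (n + 1))
      (c * ∑' n : ℕ, ((n + 1 : ℕ) : ℝ) * stopMass ν ψ (n + 1) + b * ∑' n, rejProb ν ψ φ (n + 1)
        - d - (c + r 0 b)) := by
  -- The leftover cost vanishes, because |r_N(w)| ≤ |w| + K bounds it by N P(τ > N), P(τ > N) and
  -- E[|z_N|; τ > N], up to constants.
  have hrest : Tendsto (fun N => ∫ x, cont ψ N x *
      (c * ((N + 1 : ℕ) : ℝ) + r N (b - scoreSum q N x)) ∂law ν N) atTop (𝓝 0) := by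
    have hbd : Tendsto (fun N : ℕ => |c| * (((N + 1 : ℕ) : ℝ) * surv ν ψ N)
        + (|b| + K) * surv ν ψ N + ∫ x, cont ψ N x * |scoreSum q N x| ∂law ν N)
        atTop (𝓝 0) := by
      simpa using ((hψ.tendsto_mul_surv.const_mul |c|).add
        (hψ.tendsto_surv.const_mul (|b| + K))).add
        (hψ.tendsto_cont_mul_abs_scoreSum hq2 hq0 hσ)
    refine squeeze_zero_norm (fun N => ?_) hbd
    have hS := ((memLp_scoreSum hq2 N).integrable one_le_two).abs.bdd_mul
      (measurable_cont ψ N).aestronglyMeasurable (Eventually.of_forall (abs_cont_le_one ψ N))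
    have hS' : Integrable (fun x => cont ψ N x * |scoreSum q N x|) (law ν N) := hS
    have hc := (integrable_cont ν ψ N).const_mul (|c| * ((N + 1 : ℕ) : ℝ) + (|b| + K))
    calc ‖∫ x, cont ψ N x * (c * ((N + 1 : ℕ) : ℝ) + r N (b - scoreSum q N x)) ∂law ν N‖
        ≤ ∫ x, ((|c| * ((N + 1 : ℕ) : ℝ) + (|b| + K)) * cont ψ N x
          + cont ψ N x * |scoreSum q N x|) ∂law ν N := by
          refine norm_integral_le_of_norm_le (hc.add hS') (Eventually.of_forall fun x => ?_)
          rw [norm_mul, Real.norm_eq_abs, Real.norm_eq_abs, abs_of_nonneg (cont_nonneg ψ N x)]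
          have h1 := hv.abs_r_le N (b - scoreSum q N x)
          have h2 := abs_sub b (scoreSum q N x)
          have h3 := abs_add_le (c * ((N + 1 : ℕ) : ℝ)) (r N (b - scoreSum q N x))
          rw [abs_mul, Nat.abs_cast] at h3
          have h4 : |c * ((N + 1 : ℕ) : ℝ) + r N (b - scoreSum q N x)|
              ≤ |c| * ((N + 1 : ℕ) : ℝ) + (|b| + K) + |scoreSum q N x| := by linarith
          have := mul_le_mul_of_nonneg_left h4 (cont_nonneg ψ N x)
          linarith
      _ = _ := by
          rw [integral_add hc hS', integral_const_mul, ← surv]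
          ring
  rw [hasSum_iff_tendsto_nat_of_nonneg
    (fun n => integral_nonneg fun x => hv.lossGap_nonneg ψ φ n x)]
  have h1 := hψ.summable_mul.hasSum.tendsto_sum_nat.const_mul c
  have h2 := (summable_rejProb ν ψ φ).hasSum.tendsto_sum_nat.const_mul b
  have h3 := (((h1.add h2).sub hd).add hrest).sub_const (c + r 0 b)
  rw [add_zero] at h3
  exact h3.congr fun N => (hv.lagrangian_sum hq2 ψ φ N).symm

end Lagrangian

/-! ### From the model to laws on the observation space. -/

namespace Model

variable {Ω : Type*} [MeasurableSpace Ω] (M : Model 𝓧 Ω)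

section Laws

instance : SigmaFinite M.μ := M.sigmaFinite_μ

/-- The laws of the observations. -/
noncomputable def obsLaw (θ : ℝ) (n : ℕ) : Measure 𝓧 :=
  M.μ.withDensity fun x => ENNReal.ofReal (M.f θ n x)

lemma isProbabilityMeasure_obsLaw {θ : ℝ} (hθ : θ ∈ M.Θ) (n : ℕ) :
    IsProbabilityMeasure (M.obsLaw θ n) := by
  have := M.isProbabilityMeasure_P θ hθ
  rw [obsLaw, ← M.map_X θ hθ n]
  exact Measure.isProbabilityMeasure_map (M.measurable_X n).aemeasurable

instance (n : ℕ) : IsProbabilityMeasure (M.obsLaw M.θ₀ n) :=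
  M.isProbabilityMeasure_obsLaw M.θ₀_mem n

instance : IsProbabilityMeasure (M.P M.θ₀) := M.isProbabilityMeasure_P _ M.θ₀_mem

lemma map_obs {θ : ℝ} (hθ : θ ∈ M.Θ) (n : ℕ) :
    (M.P θ).map (fun ω (i : Fin n) => M.X i ω) = law (M.obsLaw θ) n := by
  have := M.isProbabilityMeasure_P θ hθ
  have h := (M.iIndepFun_X θ hθ).precomp (Fin.val_injective (n := n))
  rw [iIndepFun.map_fun_eq_pi_map (fun i : Fin n => (M.measurable_X i).aemeasurable) h, law]
  simp only [M.map_X θ hθ, obsLaw]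

lemma expect_eq {θ : ℝ} (hθ : θ ∈ M.Θ) {n : ℕ} {F : (Fin n → 𝓧) → ℝ} (hF : Measurable F) :
    M.expect θ n F = ∫ x, F x ∂law (M.obsLaw θ) n := by
  rw [expect, ← M.map_obs hθ, integral_map _ hF.aestronglyMeasurable]
  exact (measurable_pi_lambda _ fun i : Fin n => M.measurable_X i).aemeasurable

lemma stopProb_eq {θ : ℝ} (hθ : θ ∈ M.Θ) (ψ : Rule 𝓧) (n : ℕ) :
    M.stopProb θ ψ (n + 1) = stopMass (M.obsLaw θ) ψ (n + 1) :=
  M.expect_eq hθ (measurable_s_succ ψ n)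

lemma power_eq {θ : ℝ} (hθ : θ ∈ M.Θ) (ψ φ : Rule 𝓧) :
    M.power ψ φ θ = ∑' n, rejProb (M.obsLaw θ) ψ φ (n + 1) :=
  tsum_congr fun n => M.expect_eq hθ (measurable_s_mul ψ φ n)

lemma asn₀_lt_top {ψ : Rule 𝓧} (h : M.asn₀ ψ < ⊤) :
    FiniteMean (M.obsLaw M.θ₀) ψ ∧ M.asn₀ ψ = ENNReal.ofReal
      (∑' n : ℕ, ((n + 1 : ℕ) : ℝ) * stopMass (M.obsLaw M.θ₀) ψ (n + 1)) := by
  simp only [asn₀, asn, M.stopProb_eq M.θ₀_mem] at h ⊢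
  split_ifs at h ⊢ with h1
  swap
  · exact absurd h (lt_irrefl _)
  have e : ∀ n : ℕ, ((n + 1 : ℕ) : ℝ≥0∞) * ENNReal.ofReal (stopMass (M.obsLaw M.θ₀) ψ (n + 1))
      = ENNReal.ofReal (((n + 1 : ℕ) : ℝ) * stopMass (M.obsLaw M.θ₀) ψ (n + 1)) := fun n => by
    rw [ENNReal.ofReal_mul (Nat.cast_nonneg _), ENNReal.ofReal_natCast]
  have h0 : ∀ n : ℕ, 0 ≤ ((n + 1 : ℕ) : ℝ) * stopMass (M.obsLaw M.θ₀) ψ (n + 1) := fun n =>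
    mul_nonneg (Nat.cast_nonneg _) (stopMass_nonneg _ ψ n)
  simp_rw [e] at h ⊢
  have hs : Summable fun n : ℕ => ((n + 1 : ℕ) : ℝ) * stopMass (M.obsLaw M.θ₀) ψ (n + 1) :=
    (ENNReal.summable_toReal h.ne).congr fun n => ENNReal.toReal_ofReal (h0 n)
  exact ⟨⟨h1, hs⟩, (ENNReal.ofReal_tsum_of_nonneg h0 hs).symm⟩

/-- The joint null law has density f^n_{θ₀} with respect to μⁿ, so its null sets are the sets
μⁿ-null within {f^n_{θ₀} > 0}. This is why (S) and (D) are stated there. -/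
lemma ae_law_iff (n : ℕ) (p : (Fin n → 𝓧) → Prop) :
    (∀ᵐ x ∂law (M.obsLaw M.θ₀) n, p x) ↔
      ∀ᵐ x ∂(Measure.pi fun _ : Fin n => M.μ), 0 < M.jointDensity₀ n x → p x := by
  have hf : ∀ i, Measurable fun x => ENNReal.ofReal (M.f M.θ₀ i x) := fun i =>
    (M.measurable_f _ M.θ₀_mem i).ennreal_ofReal
  have : ∀ i, SigmaFinite (M.μ.withDensity fun x => ENNReal.ofReal (M.f M.θ₀ i x)) := fun i =>
    inferInstanceAs (SigmaFinite (M.obsLaw M.θ₀ i))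
  have e : law (M.obsLaw M.θ₀) n = _ := law_withDensity M.μ hf n
  have hF : Measurable fun x : Fin n → 𝓧 => ∏ i : Fin n, ENNReal.ofReal (M.f M.θ₀ i (x i)) :=
    Finset.measurable_prod _ fun i _ => (hf i).comp (measurable_pi_apply i)
  rw [e, ae_withDensity_iff hF]
  refine eventually_congr (Eventually.of_forall fun x => ?_)
  rw [← ENNReal.ofReal_prod_of_nonneg fun (i : Fin n) _ => M.f_nonneg _ M.θ₀_mem i _]
  simp [jointDensity₀]

lemma integral_obsLaw {θ : ℝ} (hθ : θ ∈ M.Θ) (n : ℕ) (G : 𝓧 → ℝ) :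
    ∫ y, G y ∂M.obsLaw θ n = ∫ x, M.f θ n x * G x ∂M.μ := by
  rw [obsLaw, integral_withDensity_eq_integral_toReal_smul
    (M.measurable_f θ hθ n).ennreal_ofReal (by simp)]
  simp [ENNReal.toReal_ofReal (M.f_nonneg θ hθ n _)]

lemma integrable_f {θ : ℝ} (hθ : θ ∈ M.Θ) (n : ℕ) : Integrable (M.f θ n) M.μ := by
  have := M.isProbabilityMeasure_obsLaw hθ n
  refine integrable_of_integral_eq_one ?_
  simpa using (M.integral_obsLaw hθ n fun _ => 1).symm

end Laws

/-! ### The score: centring and square integrability. -/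

section Score

variable {M} {fdot : ℕ → 𝓧 → ℝ}

/-- The error in the first-order expansion of the densities. -/
noncomputable def densityError (M : Model 𝓧 Ω) (fdot : ℕ → 𝓧 → ℝ) (θ : ℝ) (n : ℕ) : ℝ :=
  ∫ x, |M.f θ n x - M.f M.θ₀ n x - (θ - M.θ₀) * fdot n x| ∂M.μ

lemma eventually_mem_Θ : ∀ᶠ θ in 𝓝 M.θ₀, θ ∈ M.Θ := M.isOpen_Θ.mem_nhds M.θ₀_mem

/-- The `L₁` derivative of the density vanishes where the null density does. -/
lemma fdot_eq_zero (h2 : M.Assumption2 fdot) (n : ℕ) :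
    ∀ᵐ x ∂M.μ, M.f M.θ₀ n x = 0 → fdot n x = 0 := by
  have hAm : MeasurableSet {x | M.f M.θ₀ n x = 0} :=
    M.measurable_f _ M.θ₀_mem n (measurableSet_singleton 0)
  set A := {x | M.f M.θ₀ n x = 0} with hA
  have hfd := (h2 n).1
  have hInt : ∀ θ ∈ M.Θ,
      Integrable (fun x => |M.f θ n x - M.f M.θ₀ n x - (θ - M.θ₀) * fdot n x|) M.μ :=
    fun θ hθ => (((M.integrable_f hθ n).sub (M.integrable_f M.θ₀_mem n)).sub
      (hfd.const_mul _)).abs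
  -- Densities are nonnegative and the null density is 0 on `A`. So there the linear term has the
  -- wrong sign at one of θ₀ ± h, and the error at that point is at least h |fdot|.
  have hbound : ∀ h > 0, M.θ₀ + h ∈ M.Θ → M.θ₀ - h ∈ M.Θ → h * ∫ x in A, |fdot n x| ∂M.μ
      ≤ densityError M fdot (M.θ₀ + h) n + densityError M fdot (M.θ₀ - h) n := by
    intro h hh hp hm
    have i1 := hInt _ hp
    have i2 := hInt _ hm
    rw [← integral_const_mul, densityError, densityError, ← integral_add i1 i2]
    have h12 := i1.add i2
    refine le_trans ?_ (setIntegral_le_integral (s := A) h12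
      (Eventually.of_forall fun x => add_nonneg (abs_nonneg _) (abs_nonneg _)))
    refine setIntegral_mono_on (hfd.abs.const_mul h).integrableOn h12.integrableOn hAm
      fun x hx => ?_
    have hx0 : M.f M.θ₀ n x = 0 := hx
    have p1 := M.f_nonneg _ hp n x
    have p2 := M.f_nonneg _ hm n x
    simp only [hx0, sub_zero, add_sub_cancel_left, sub_sub_cancel_left]
    rcases le_total 0 (fdot n x) with hs | hs
    · rw [abs_of_nonneg hs]
      have := le_abs_self (M.f (M.θ₀ - h) n x - -h * fdot n x)
      have := abs_nonneg (M.f (M.θ₀ + h) n x - h * fdot n x)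
      linarith
    · rw [abs_of_nonpos hs]
      have := le_abs_self (M.f (M.θ₀ + h) n x - h * fdot n x)
      have := abs_nonneg (M.f (M.θ₀ - h) n x - -h * fdot n x)
      linarith
  have hJ : ∫ x in A, |fdot n x| ∂M.μ ≤ 0 := by
    refine le_of_forall_pos_le_add fun η hη => ?_
    obtain ⟨ρ, hρ, hball⟩ := Metric.eventually_nhds_iff.1
      ((eventually_mem_Θ (M := M)).and ((h2 n).2.def (half_pos hη)))
    have e1 := @hball (M.θ₀ + ρ / 2) (by simp [abs_of_pos hρ, hρ])
    have e2 := @hball (M.θ₀ - ρ / 2) (by simp [abs_of_pos hρ, hρ])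
    have hb := hbound (ρ / 2) (half_pos hρ) e1.1 e2.1
    have d1 := (le_abs_self _).trans e1.2
    have d2 := (le_abs_self _).trans e2.2
    simp only [add_sub_cancel_left, sub_sub_cancel_left, norm_neg, Real.norm_eq_abs,
      abs_of_pos (half_pos hρ)] at d1 d2
    simp only [densityError, add_sub_cancel_left, sub_sub_cancel_left] at hb
    refine le_of_mul_le_mul_left ?_ (half_pos hρ)
    linarith
  have hz := (setIntegral_eq_zero_iff_of_nonneg_ae
    (Eventually.of_forall fun x => abs_nonneg (fdot n x)) hfd.abs.integrableOn).1
    (le_antisymm hJ (integral_nonneg fun x => abs_nonneg _))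
  filter_upwards [(ae_restrict_iff' hAm).1 hz] with x hx hx0
  simpa using hx hx0

/-- A measurable version of the score. -/
noncomputable def score (h2 : M.Assumption2 fdot) (n : ℕ) (x : 𝓧) : ℝ :=
  (h2 n).1.1.mk (fdot n) x / M.f M.θ₀ n x

variable (h2 : M.Assumption2 fdot)
include h2

lemma measurable_score (n : ℕ) : Measurable (score h2 n) :=
  (h2 n).1.1.stronglyMeasurable_mk.measurable.div (M.measurable_f _ M.θ₀_mem n)

lemma score_ae_eq (n : ℕ) : ∀ᵐ x ∂M.obsLaw M.θ₀ n, M.q fdot n x = score h2 n x := by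
  have h : ∀ᵐ x ∂M.μ, M.q fdot n x = score h2 n x := by
    filter_upwards [(h2 n).1.1.ae_eq_mk] with x hx
    rw [q, score, ← hx]
  exact (withDensity_absolutelyContinuous _ _).ae_le h

lemma f_mul_score_ae_eq (n : ℕ) :
    ∀ᵐ x ∂M.μ, M.f M.θ₀ n x * score h2 n x = fdot n x := by
  filter_upwards [(h2 n).1.1.ae_eq_mk, fdot_eq_zero h2 n] with x hx h0
  rw [score, ← hx]
  by_cases hf : M.f M.θ₀ n x = 0
  · rw [h0 hf]; simp
  · field_simp

lemma integrable_score (n : ℕ) : Integrable (score h2 n) (M.obsLaw M.θ₀ n) := by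
  rw [obsLaw, integrable_withDensity_iff (M.measurable_f _ M.θ₀_mem n).ennreal_ofReal (by simp)]
  refine (h2 n).1.congr ?_
  filter_upwards [f_mul_score_ae_eq h2 n] with x hx
  rw [ENNReal.toReal_ofReal (M.f_nonneg _ M.θ₀_mem n x), mul_comm, hx]

lemma integral_mul_score (n : ℕ) (G : 𝓧 → ℝ) :
    ∫ y, G y * score h2 n y ∂M.obsLaw M.θ₀ n = ∫ x, G x * fdot n x ∂M.μ := by
  rw [M.integral_obsLaw M.θ₀_mem]
  refine integral_congr_ae ?_
  filter_upwards [f_mul_score_ae_eq h2 n] with x hx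
  rw [← hx]; ring

/-- The first-order expansion of the law of a single observation. -/
lemma abs_integral_obsLaw_sub_le {θ : ℝ} (hθ : θ ∈ M.Θ) (n : ℕ) {G : 𝓧 → ℝ} (hG : Measurable G)
    {B : ℝ} (hB : ∀ y, |G y| ≤ B) :
    |∫ y, G y ∂M.obsLaw θ n - ∫ y, G y ∂M.obsLaw M.θ₀ n
      - (θ - M.θ₀) * ∫ y, G y * score h2 n y ∂M.obsLaw M.θ₀ n|
      ≤ B * densityError M fdot θ n := by
  have hb := Eventually.of_forall (f := ae M.μ) hB
  have i1 : Integrable (fun x => M.f θ n x * G x) M.μ :=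
    (M.integrable_f hθ n).mul_bdd hG.aestronglyMeasurable hb
  have i2 : Integrable (fun x => M.f M.θ₀ n x * G x) M.μ :=
    (M.integrable_f M.θ₀_mem n).mul_bdd hG.aestronglyMeasurable hb
  have i3 : Integrable (fun x => (θ - M.θ₀) * (G x * fdot n x)) M.μ :=
    ((h2 n).1.bdd_mul hG.aestronglyMeasurable hb).const_mul _
  have i12 : Integrable (fun x => M.f θ n x * G x - M.f M.θ₀ n x * G x) M.μ := i1.sub i2
  have i4 : Integrable (fun x => |M.f θ n x - M.f M.θ₀ n x - (θ - M.θ₀) * fdot n x|) M.μ :=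
    (((M.integrable_f hθ n).sub (M.integrable_f M.θ₀_mem n)).sub ((h2 n).1.const_mul _)).abs
  rw [integral_mul_score, M.integral_obsLaw hθ, M.integral_obsLaw M.θ₀_mem, ← integral_const_mul,
    ← integral_sub i1 i2, ← integral_sub i12 i3, densityError, ← integral_const_mul]
  refine abs_integral_le_integral_abs.trans
    (integral_mono (i12.sub i3).abs (i4.const_mul B) fun x => ?_)
  have e : M.f θ n x * G x - M.f M.θ₀ n x * G x - (θ - M.θ₀) * (G x * fdot n x)
      = G x * (M.f θ n x - M.f M.θ₀ n x - (θ - M.θ₀) * fdot n x) := by ring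
  simp only [e, abs_mul]
  exact mul_le_mul_of_nonneg_right (hB x) (abs_nonneg _)

lemma hasDerivAt_integral_obsLaw (n : ℕ) {G : 𝓧 → ℝ} (hG : Measurable G) {B : ℝ}
    (hB : ∀ y, |G y| ≤ B) :
    HasDerivAt (fun θ => ∫ y, G y ∂M.obsLaw θ n)
      (∫ y, G y * score h2 n y ∂M.obsLaw M.θ₀ n) M.θ₀ := by
  rw [hasDerivAt_iff_isLittleO]
  refine IsBigO.trans_isLittleO ?_ (h2 n).2
  refine IsBigO.of_bound B ?_
  filter_upwards [eventually_mem_Θ (M := M)] with θ hθ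
  have := abs_integral_obsLaw_sub_le h2 hθ n hG hB
  rwa [smul_eq_mul, Real.norm_eq_abs, Real.norm_eq_abs,
    abs_of_nonneg (integral_nonneg fun x => abs_nonneg _)]

/-- Differentiate the total mass, which is constantly 1 near θ₀. -/
lemma integral_score (n : ℕ) : ∫ y, score h2 n y ∂M.obsLaw M.θ₀ n = 0 := by
  have h := hasDerivAt_integral_obsLaw h2 n (G := fun _ => 1) measurable_const (B := 1)
    (by simp)
  have h' : HasDerivAt (fun θ => ∫ _, (1 : ℝ) ∂M.obsLaw θ n) 0 M.θ₀ := by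
    refine (hasDerivAt_const M.θ₀ (1 : ℝ)).congr_of_eventuallyEq ?_
    filter_upwards [eventually_mem_Θ (M := M)] with θ hθ
    have := M.isProbabilityMeasure_obsLaw hθ n
    simp
  simpa using h.unique h'

variable {γ₁ : ℝ} (hγ : 0 < γ₁) (h1 : ∀ᶠ θ in 𝓝 M.θ₀, ∀ n,
    InformationTheory.klDiv (M.obsLaw M.θ₀ n) (M.obsLaw θ n)
      ≤ ENNReal.ofReal (γ₁ * (θ - M.θ₀) ^ 2))
include hγ h1

/-- The Kullback–Leibler bound makes the score square integrable, here against bounded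
functions. -/
lemma sq_integral_mul_score_le (n : ℕ) {G : 𝓧 → ℝ} (hG : Measurable G) {B : ℝ}
    (hB : ∀ y, |G y| ≤ B) :
    (∫ y, G y * score h2 n y ∂M.obsLaw M.θ₀ n) ^ 2
      ≤ 4 * γ₁ * ∫ y, G y ^ 2 ∂M.obsLaw M.θ₀ n := by
  have hB2 : ∀ y, |G y ^ 2| ≤ B ^ 2 := fun y => by
    rw [abs_pow]; exact pow_le_pow_left₀ (abs_nonneg _) (hB y) 2
  -- Divide the Hellinger bound by (θ − θ₀)² and let θ → θ₀. Both expectations of G² then agree, and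
  -- 2 · 2γ₁ gives the constant.
  have hl := (hasDerivAt_integral_obsLaw h2 n hG hB).tendsto_slope.pow 2
  have hc := (hasDerivAt_integral_obsLaw h2 n (hG.pow_const 2) hB2).continuousAt.tendsto
  have hr : Tendsto (fun θ => γ₁ * (2 * (∫ y, G y ^ 2 ∂M.obsLaw M.θ₀ n
      + ∫ y, G y ^ 2 ∂M.obsLaw θ n))) (𝓝[≠] M.θ₀)
      (𝓝 (γ₁ * (2 * (∫ y, G y ^ 2 ∂M.obsLaw M.θ₀ n + ∫ y, G y ^ 2 ∂M.obsLaw M.θ₀ n)))) :=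
    (((hc.mono_left nhdsWithin_le_nhds).const_add _).const_mul 2).const_mul γ₁
  refine (le_of_tendsto_of_tendsto hl hr ?_).trans (le_of_eq (by ring))
  filter_upwards [nhdsWithin_le_nhds h1, nhdsWithin_le_nhds (eventually_mem_Θ (M := M)),
    self_mem_nhdsWithin] with θ hk hθ hne
  have := M.isProbabilityMeasure_obsLaw hθ n
  have hd : 0 < (θ - M.θ₀) ^ 2 := by
    have : θ - M.θ₀ ≠ 0 := sub_ne_zero.2 hne
    positivity
  have hb := sq_integral_sub_le_of_klDiv_le (mul_nonneg hγ.le hd.le) (hk n) hG hB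
  rw [slope_def_field, div_pow, div_le_iff₀ hd]
  nlinarith

/-- Take for `G` the score truncated at level `k`. Then G times the score is G², so (E G²)² ≤ 4γ₁ E
G², and cancelling gives E G² ≤ 4γ₁ for every `k`. Fatou's lemma removes the truncation. -/
lemma memLp_score (n : ℕ) : MemLp (score h2 n) 2 (M.obsLaw M.θ₀ n) ∧
    ∫ y, score h2 n y ^ 2 ∂M.obsLaw M.θ₀ n ≤ 4 * γ₁ := by
  have hm := measurable_score h2 n
  have hset : ∀ k : ℕ, MeasurableSet {y | |score h2 n y| ≤ k} := fun k =>
    measurableSet_le hm.abs measurable_const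
  have hGm : ∀ k : ℕ, Measurable ({y | |score h2 n y| ≤ k}.indicator (score h2 n)) := fun k =>
    hm.indicator (hset k)
  have hGb : ∀ (k : ℕ) y, |{y | |score h2 n y| ≤ k}.indicator (score h2 n) y| ≤ k := by
    intro k y
    by_cases hy : |score h2 n y| ≤ k
    · rwa [Set.indicator_of_mem (by exact hy)]
    · rw [Set.indicator_of_notMem (by exact hy)]; simp
  have hGq : ∀ (k : ℕ) y, {y | |score h2 n y| ≤ k}.indicator (score h2 n) y * score h2 n y
      = {y | |score h2 n y| ≤ k}.indicator (score h2 n) y ^ 2 := by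
    intro k y
    by_cases hy : |score h2 n y| ≤ k
    · rw [Set.indicator_of_mem (by exact hy), sq]
    · rw [Set.indicator_of_notMem (by exact hy)]; simp
  have htr : ∀ k : ℕ,
      ∫ y, {y | |score h2 n y| ≤ k}.indicator (score h2 n) y ^ 2 ∂M.obsLaw M.θ₀ n ≤ 4 * γ₁ := by
    intro k
    have := sq_integral_mul_score_le h2 hγ h1 n (hGm k) (hGb k)
    simp_rw [hGq] at this
    have h0 : 0 ≤ ∫ y, {y | |score h2 n y| ≤ k}.indicator (score h2 n) y ^ 2
      ∂M.obsLaw M.θ₀ n := integral_nonneg fun y => sq_nonneg _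
    rcases h0.eq_or_lt with h0 | h0
    · rw [← h0]; positivity
    · rw [sq] at this
      exact le_of_mul_le_mul_right this h0
  have hlim : ∀ y, Tendsto (fun k : ℕ =>
      ENNReal.ofReal ({y | |score h2 n y| ≤ k}.indicator (score h2 n) y ^ 2)) atTop
      (𝓝 (ENNReal.ofReal (score h2 n y ^ 2))) := by
    intro y
    obtain ⟨K, hK⟩ := exists_nat_ge |score h2 n y|
    refine tendsto_const_nhds.congr' ?_
    filter_upwards [eventually_ge_atTop K] with k hk
    have : |score h2 n y| ≤ k := hK.trans (by exact_mod_cast hk)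
    rw [Set.indicator_of_mem (by exact this)]
  have hlint : ∫⁻ y, ENNReal.ofReal (score h2 n y ^ 2) ∂M.obsLaw M.θ₀ n
      ≤ ENNReal.ofReal (4 * γ₁) := by
    have e : ∀ y, ENNReal.ofReal (score h2 n y ^ 2) = liminf (fun k : ℕ =>
      ENNReal.ofReal ({y | |score h2 n y| ≤ k}.indicator (score h2 n) y ^ 2)) atTop :=
      fun y => (hlim y).liminf_eq.symm
    simp_rw [e]
    refine (lintegral_liminf_le fun k => ((hGm k).pow_const 2).ennreal_ofReal).trans ?_
    refine liminf_le_of_frequently_le' (Frequently.of_forall fun k => ?_)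
    rw [← ofReal_integral_eq_lintegral_ofReal
      (integrable_of_bounded (B := (k : ℝ) ^ 2) ((hGm k).pow_const 2) fun y => by
        rw [abs_pow]; exact pow_le_pow_left₀ (abs_nonneg _) (hGb k y) 2)
      (Eventually.of_forall fun y => sq_nonneg _)]
    exact ENNReal.ofReal_le_ofReal (htr k)
  have hsq : Integrable (fun y => score h2 n y ^ 2) (M.obsLaw M.θ₀ n) := by
    refine ⟨(hm.pow_const 2).aestronglyMeasurable, ?_⟩
    rw [hasFiniteIntegral_iff_ofReal (Eventually.of_forall fun y => sq_nonneg _)]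
    exact hlint.trans_lt ENNReal.ofReal_lt_top
  refine ⟨(memLp_two_iff_integrable_sq hm.aestronglyMeasurable).2 hsq, ?_⟩
  rw [integral_eq_lintegral_of_nonneg_ae (Eventually.of_forall fun y => sq_nonneg _) hsq.1]
  exact ENNReal.toReal_le_of_le_ofReal (by positivity) hlint

omit h1 in
omit hγ in
lemma integral_abs_score_le {γ₂ : ℝ} (hγ₂ : 0 ≤ γ₂)
    (h3 : ∀ j, ∫⁻ ω, ‖M.q fdot j (M.X j ω)‖ₑ ∂(M.P M.θ₀) ≤ ENNReal.ofReal γ₂) (n : ℕ) :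
    ∫ y, |score h2 n y| ∂M.obsLaw M.θ₀ n ≤ γ₂ := by
  have hmap : (M.P M.θ₀).map (M.X n) = M.obsLaw M.θ₀ n := M.map_X _ M.θ₀_mem n
  have hae : ∀ᵐ ω ∂M.P M.θ₀, M.q fdot n (M.X n ω) = score h2 n (M.X n ω) :=
    ae_of_ae_map (M.measurable_X n).aemeasurable (hmap ▸ score_ae_eq h2 n)
  have hl : ∫⁻ y, ‖score h2 n y‖ₑ ∂M.obsLaw M.θ₀ n ≤ ENNReal.ofReal γ₂ := by
    rw [← hmap, lintegral_map (measurable_score h2 n).enorm (M.measurable_X n)]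
    refine le_of_eq_of_le (lintegral_congr_ae ?_) (h3 n)
    filter_upwards [hae] with ω hω
    rw [hω]
  have e := integral_norm_eq_lintegral_enorm
    (measurable_score h2 n).aestronglyMeasurable (μ := M.obsLaw M.θ₀ n)
  simp only [Real.norm_eq_abs] at e
  rw [e]
  exact ENNReal.toReal_le_of_le_ofReal hγ₂ hl

end Score

end Model

/-! ### Zero losses and the forms (S) and (D). -/

lemma ite_le_and_le_ite_iff {p q : Prop} [Decidable p] [Decidable q] {u : ℝ} (h0 : 0 ≤ u)
    (h1 : u ≤ 1) :
    ((if p then (1 : ℝ) else 0) ≤ u ∧ u ≤ if q then (1 : ℝ) else 0) ↔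
      (p → u = 1) ∧ (¬q → u = 0) := by
  refine and_congr ?_ ?_
  · by_cases hp : p
    · simp only [hp, true_imp_iff]
      exact ⟨fun h => le_antisymm h1 h, fun h => h.ge⟩
    · simp [hp, h0]
  · by_cases hq : q
    · simp [hq, h1]
    · simp only [hq, not_false_iff, true_imp_iff]
      exact ⟨fun h => le_antisymm h h0, fun h => h.le⟩

/-- The loss is the cost difference of stopping and going on, times the probability of the inferior
choice. At a tie it is zero whatever the rule does. -/
lemma IsOptimalValue.stopGap_eq_zero_iff {ν : ℕ → Measure 𝓧} {q : ℕ → 𝓧 → ℝ} {b c K : ℝ}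
    {v r : ℕ → ℝ → ℝ} (hv : IsOptimalValue ν q c K v r) (ψ : Rule 𝓧) (n : ℕ) (x : Fin n → 𝓧) :
    stopGap q b c v r ψ n x = 0 ↔
      (g (b - scoreSum q n x) < c + r n (b - scoreSum q n x) → ψ.val n x = 1) ∧
      (¬g (b - scoreSum q n x) ≤ c + r n (b - scoreSum q n x) → ψ.val n x = 0) := by
  rw [stopGap, hv.v_eq]
  generalize g (b - scoreSum q n x) = u
  generalize c + r n (b - scoreSum q n x) = w
  generalize ψ.val n x = p
  rcases lt_trichotomy u w with h | rfl | h
  · have e : p * u + (1 - p) * w - min u w = (1 - p) * (w - u) := by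
      rw [min_eq_left h.le]; ring
    rw [e]
    simp [h, h.le, sub_eq_zero, h.ne', eq_comm (a := (1 : ℝ))]
  · simp; ring
  · have e : p * u + (1 - p) * w - min u w = p * (u - w) := by
      rw [min_eq_right h.le]; ring
    rw [e]
    simp [h, h.not_gt, sub_eq_zero, h.ne']

lemma decGap_eq_zero_iff (q : ℕ → 𝓧 → ℝ) (b : ℝ) (φ : Rule 𝓧) (n : ℕ) (x : Fin n → 𝓧) :
    decGap q b φ n x = 0 ↔ (b < scoreSum q n x → φ.val n x = 1) ∧
      (¬b ≤ scoreSum q n x → φ.val n x = 0) := by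
  rw [decGap, g]
  generalize scoreSum q n x = u
  generalize φ.val n x = p
  rcases lt_trichotomy b u with h | rfl | h
  · have e : p * (b - u) - min 0 (b - u) = (1 - p) * (u - b) := by
      rw [min_eq_right (by linarith)]; ring
    rw [e]
    simp [h, h.le, sub_eq_zero, h.ne', eq_comm (a := (1 : ℝ))]
  · simp
  · have e : p * (b - u) - min 0 (b - u) = p * (b - u) := by
      rw [min_eq_left (by linarith)]; ring
    rw [e]
    simp [h, h.not_gt, sub_eq_zero, h.ne']

namespace Model

variable {Ω : Type*} [MeasurableSpace Ω] {M : Model 𝓧 Ω}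
  {fdot : ℕ → 𝓧 → ℝ}

lemma Assumption1.eventually_klDiv_le (h1 : M.Assumption1) : ∃ γ₁ > (0 : ℝ),
    ∀ᶠ θ in 𝓝 M.θ₀, ∀ n, InformationTheory.klDiv (M.obsLaw M.θ₀ n) (M.obsLaw θ n)
      ≤ ENNReal.ofReal (γ₁ * (θ - M.θ₀) ^ 2) := by
  obtain ⟨δ, hδ, γ₁, hγ, h⟩ := h1
  refine ⟨γ₁, hγ, ?_⟩
  filter_upwards [eventually_mem_Θ (M := M), Metric.closedBall_mem_nhds M.θ₀ hδ] with θ hθ hd n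
  have := h n θ hθ hd
  rwa [M.map_X _ M.θ₀_mem, M.map_X _ hθ] at this

lemma z_ae_eq (h2 : M.Assumption2 fdot) (n : ℕ) :
    ∀ᵐ x ∂law (M.obsLaw M.θ₀) n, M.z fdot n x = scoreSum (score h2) n x := by
  have hpos : ∀ᵐ x ∂law (M.obsLaw M.θ₀) n, 0 < M.jointDensity₀ n x :=
    (M.ae_law_iff n _).2 (Eventually.of_forall fun _ h => h)
  have hq : ∀ᵐ x ∂law (M.obsLaw M.θ₀) n, ∀ i : Fin n, M.q fdot i (x i) = score h2 i (x i) :=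
    ae_all_iff.2 fun i => (measurePreserving_eval
      (fun i : Fin n => M.obsLaw M.θ₀ i) i).quasiMeasurePreserving.ae (score_ae_eq h2 i)
  filter_upwards [hpos, hq] with x h0 hx
  rw [z, if_neg h0.ne', scoreSum]
  exact Finset.sum_congr rfl fun i _ => hx i

lemma integral_shift_score (h2 : M.Assumption2 fdot) {V : ℝ → ℝ} (hV : LipschitzWith 1 V)
    (n : ℕ) (z : ℝ) :
    ∫ ω, V (z - M.q fdot n (M.X n ω)) ∂M.P M.θ₀
      = ∫ y, V (z - score h2 n y) ∂M.obsLaw M.θ₀ n := by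
  have hmap : (M.P M.θ₀).map (M.X n) = M.obsLaw M.θ₀ n := M.map_X _ M.θ₀_mem n
  have hae : ∀ᵐ ω ∂M.P M.θ₀, M.q fdot n (M.X n ω) = score h2 n (M.X n ω) :=
    ae_of_ae_map (M.measurable_X n).aemeasurable (hmap ▸ score_ae_eq h2 n)
  have hm : Measurable fun y => V (z - score h2 n y) :=
    hV.continuous.measurable.comp ((measurable_score h2 n).const_sub z)
  rw [← hmap, integral_map (M.measurable_X n).aemeasurable hm.aestronglyMeasurable]
  refine integral_congr_ae ?_
  filter_upwards [hae] with ω hω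
  rw [hω]

lemma vAux_eq (h2 : M.Assumption2 fdot) (c : ℝ) (k n : ℕ) :
    M.vAux fdot c k n = truncValue (M.obsLaw M.θ₀) (score h2) c k n := by
  induction k generalizing n with
  | zero => rfl
  | succ k ih =>
    ext z
    rw [vAux, ih, truncValue, integral_shift_score h2
      (lipschitzWith_truncValue _ c (integrable_score h2) k (n + 1))]

lemma rTrunc_eq (h2 : M.Assumption2 fdot) (c : ℝ) (N n : ℕ) (z : ℝ) :
    M.rTrunc fdot c N n z = truncContValue (M.obsLaw M.θ₀) (score h2) c (N - (n + 1)) n z := by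
  simp only [rTrunc, v, vAux_eq h2]
  exact integral_shift_score h2 (lipschitzWith_truncValue _ c (integrable_score h2) _ (n + 1)) n z

/-- Horizon `N` leaves N − (n + 1) steps after the next observation; the truncated subtraction
affects only finitely many `N`. The limit is finite, so the `EReal` limit is its coercion. -/
lemma r_eq (h2 : M.Assumption2 fdot) {c : ℝ} (n : ℕ) (z : ℝ)
    (h : Tendsto (fun k => truncContValue (M.obsLaw M.θ₀) (score h2) c k n z) atTop
      (𝓝 (contValue (M.obsLaw M.θ₀) (score h2) c n z))) :
    M.r fdot c n z = (contValue (M.obsLaw M.θ₀) (score h2) c n z : EReal) := by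
  refine Tendsto.limUnder_eq ?_
  simp_rw [rTrunc_eq h2]
  exact (continuous_coe_real_ereal.tendsto _).comp (h.comp (tendsto_sub_atTop_nat (n + 1)))

lemma forall_one_le_ae_iff {p u : (n : ℕ) → (Fin n → 𝓧) → Prop} :
    (∀ n : ℕ, 1 ≤ n → ∀ᵐ x ∂(Measure.pi fun _ : Fin n => M.μ),
      u n x → 0 < M.jointDensity₀ n x → p n x) ↔
      ∀ n : ℕ, ∀ᵐ x ∂law (M.obsLaw M.θ₀) (n + 1), u (n + 1) x → p (n + 1) x := by
  have h : ∀ n : ℕ, (∀ᵐ x ∂(Measure.pi fun _ : Fin n => M.μ),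
      u n x → 0 < M.jointDensity₀ n x → p n x) ↔
      ∀ᵐ x ∂law (M.obsLaw M.θ₀) n, u n x → p n x := fun n => by
    rw [M.ae_law_iff]
    exact eventually_congr (Eventually.of_forall fun x => imp.swap)
  constructor
  · exact fun H n => (h (n + 1)).1 (H (n + 1) (Nat.le_add_left 1 n))
  · intro H n hn
    obtain ⟨m, rfl⟩ := Nat.exists_eq_add_of_le' hn
    exact (h (m + 1)).2 (H m)

section Forms

variable (h2 : M.Assumption2 fdot) {b c K : ℝ}

lemma stoppingForm_iff {v : ℕ → ℝ → ℝ}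
    (hv : IsOptimalValue (M.obsLaw M.θ₀) (score h2) c K v
      (contValue (M.obsLaw M.θ₀) (score h2) c))
    (hr : ∀ n z, M.r fdot c n z = (contValue (M.obsLaw M.θ₀) (score h2) c n z : EReal))
    (ψ : Rule 𝓧) :
    M.StoppingForm fdot b c ψ ↔ ∀ n, ∀ᵐ x ∂law (M.obsLaw M.θ₀) (n + 1), 0 < t ψ (n + 1) x →
      stopGap (score h2) b c v (contValue (M.obsLaw M.θ₀) (score h2) c) ψ (n + 1) x = 0 := by
  rw [StoppingForm, forall_one_le_ae_iff (u := fun n x => 0 < t ψ n x)]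
  refine forall_congr' fun n => ?_
  refine eventually_congr ?_
  filter_upwards [z_ae_eq h2 (n + 1)] with x hx
  refine imp_congr_right fun _ => ?_
  rw [hv.stopGap_eq_zero_iff, ite_le_and_le_ite_iff (ψ.nonneg _ x) (ψ.le_one _ x), hx, hr,
    ← EReal.coe_add, EReal.coe_lt_coe_iff, EReal.coe_le_coe_iff]

lemma decisionForm_iff (ψ φ : Rule 𝓧) :
    M.DecisionForm fdot b ψ φ ↔ ∀ n, ∀ᵐ x ∂law (M.obsLaw M.θ₀) (n + 1), 0 < s ψ (n + 1) x →
      decGap (score h2) b φ (n + 1) x = 0 := by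
  rw [DecisionForm, forall_one_le_ae_iff (u := fun n x => 0 < s ψ n x)]
  refine forall_congr' fun n => ?_
  refine eventually_congr ?_
  filter_upwards [z_ae_eq h2 (n + 1)] with x hx
  refine imp_congr_right fun _ => ?_
  rw [decGap_eq_zero_iff, ite_le_and_le_ite_iff (φ.nonneg _ x) (φ.le_one _ x), hx]

/-- A test has the optimal form if and only if it has no loss at any stage. -/
lemma forms_iff {v : ℕ → ℝ → ℝ}
    (hv : IsOptimalValue (M.obsLaw M.θ₀) (score h2) c K v
      (contValue (M.obsLaw M.θ₀) (score h2) c))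
    (hr : ∀ n z, M.r fdot c n z = (contValue (M.obsLaw M.θ₀) (score h2) c n z : EReal))
    (hq2 : ∀ n, MemLp (score h2 n) 2 (M.obsLaw M.θ₀ n)) (ψ φ : Rule 𝓧) :
    M.StoppingForm fdot b c ψ ∧ M.DecisionForm fdot b ψ φ ↔
      ∀ n, ∫ x, lossGap (score h2) b c v (contValue (M.obsLaw M.θ₀) (score h2) c) ψ φ n x
        ∂law (M.obsLaw M.θ₀) (n + 1) = 0 := by
  rw [stoppingForm_iff h2 hv hr, decisionForm_iff h2, ← forall_and]
  refine forall_congr' fun n => ?_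
  rw [integral_eq_zero_iff_of_nonneg (fun x => hv.lossGap_nonneg ψ φ n x)
    (hv.lagrangian_step hq2 ψ φ n).1, ← eventually_and]
  refine eventually_congr (Eventually.of_forall fun x => ?_)
  have ht := t_succ_nonneg ψ n x
  have hs := s_succ_nonneg ψ n x
  simp only [lossGap, Pi.zero_apply]
  rw [add_eq_zero_iff_of_nonneg
    (mul_nonneg ht (hv.stopGap_nonneg ψ _ x)) (mul_nonneg hs (decGap_nonneg φ _ x)),
    mul_eq_zero, mul_eq_zero]
  refine and_congr ?_ ?_
  · rw [ht.lt_iff_ne, ← or_iff_not_imp_left, eq_comm]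
  · rw [hs.lt_iff_ne, ← or_iff_not_imp_left, eq_comm]

end Forms

/-- The power function of a test with a finite null average sample number is differentiable at
`θ₀`, with the limit of the derivatives of the truncated power functions as its derivative. -/
lemma exists_hasDerivAt_power (h2 : M.Assumption2 fdot) (h3 : M.Assumption3 fdot) {γ₁ : ℝ}
    (hγ : 0 < γ₁) (h1 : ∀ᶠ θ in 𝓝 M.θ₀, ∀ n,
      InformationTheory.klDiv (M.obsLaw M.θ₀ n) (M.obsLaw θ n)
        ≤ ENNReal.ofReal (γ₁ * (θ - M.θ₀) ^ 2))
    (ψ φ : Rule 𝓧) (hψ : FiniteMean (M.obsLaw M.θ₀) ψ) :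
    ∃ d, Tendsto (truncDeriv (M.obsLaw M.θ₀) (score h2) ψ φ) atTop (𝓝 d) ∧
      HasDerivAt (M.power ψ φ) d M.θ₀ := by
  obtain ⟨γ₂, hγ₂, h3⟩ := h3
  -- The constant 2√γ₁ comes from the Hellinger bound for |G| ≤ 1: its right side is at most γ₁(θ −
  -- θ₀)² · 2(1 + 1).
  obtain ⟨d, hd, hd'⟩ := exists_hasDerivAt_tsum_rejProb (m := M.obsLaw) (θ₀ := M.θ₀)
    (ν := M.obsLaw M.θ₀) (q := score h2) (C := 2 * √γ₁) (A := γ₂) (σ2 := 4 * γ₁) rfl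
    ((eventually_mem_Θ (M := M)).mono fun θ hθ n => M.isProbabilityMeasure_obsLaw hθ n)
    (measurable_score h2) (fun n => (memLp_score h2 hγ h1 n).1) (integral_score h2)
    (fun n => (memLp_score h2 hγ h1 n).2) (integral_abs_score_le h2 hγ₂.le h3) (by positivity)
    (by
      filter_upwards [h1, eventually_mem_Θ (M := M)] with θ hk hθ n G hG hB
      have := M.isProbabilityMeasure_obsLaw hθ n
      have hb := sq_integral_sub_le_of_klDiv_le (by positivity) (hk n) hG hB
      have hG2 : ∀ m : Measure 𝓧, IsProbabilityMeasure m → ∫ y, G y ^ 2 ∂m ≤ 1 := by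
        intro m hm
        calc ∫ y, G y ^ 2 ∂m ≤ ∫ _, (1 : ℝ) ∂m :=
              integral_mono_of_nonneg (Eventually.of_forall fun y => sq_nonneg _)
                (integrable_const _) (Eventually.of_forall fun y => by
                  exact (sq_le_one_iff_abs_le_one _).2 (hB y))
          _ = 1 := by simp
      have h4 := hG2 (M.obsLaw M.θ₀ n) inferInstance
      have h5 := hG2 (M.obsLaw θ n) this
      rw [abs_sub_comm]
      refine abs_le_of_sq_le_sq ?_ (by positivity)
      have h6 : (2 * √γ₁ * |θ - M.θ₀|) ^ 2 = γ₁ * (θ - M.θ₀) ^ 2 * (2 * (1 + 1)) := by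
        rw [mul_pow, mul_pow, Real.sq_sqrt hγ.le, sq_abs]; ring
      rw [h6]
      refine hb.trans (mul_le_mul_of_nonneg_left ?_ (by positivity))
      linarith)
    (ω := densityError M fdot) (fun n => (h2 n).2)
    ((eventually_mem_Θ (M := M)).mono fun θ hθ n G hG B hB =>
      abs_integral_obsLaw_sub_le h2 hθ n hG hB) ψ φ hψ
  exact ⟨d, hd, hd'.congr_of_eventuallyEq
    ((eventually_mem_Θ (M := M)).mono fun θ hθ => M.power_eq hθ ψ φ)⟩

end Model

end SeqTest

/-! ### The optimality theorem. -/

theorem theorem5 {𝓧 Ω : Type*} [MeasurableSpace 𝓧] [MeasurableSpace Ω]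
    (M : SeqTest.Model 𝓧 Ω) (fdot : ℕ → 𝓧 → ℝ)
    (h1 : M.Assumption1) (h2 : M.Assumption2 fdot) (h3 : M.Assumption3 fdot)
    (b c : ℝ) (hb : 0 < b) (hc : 0 < c)
    (ψ φ : SeqTest.Rule 𝓧)
    (hψ : M.StoppingForm fdot b c ψ) (hφ : M.DecisionForm fdot b ψ φ)
    (hfin : M.asn₀ ψ < ⊤) :
    (∀ ψ' φ' : SeqTest.Rule 𝓧, M.asn₀ ψ' < ⊤ →
      DifferentiableAt ℝ (M.power ψ' φ') M.θ₀) ∧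
    ∀ ψ' φ' : SeqTest.Rule 𝓧, M.asn₀ ψ' < ⊤ →
      M.alpha ψ' φ' ≤ M.alpha ψ φ → M.asn₀ ψ' ≤ M.asn₀ ψ →
        M.powerDeriv ψ' φ' ≤ M.powerDeriv ψ φ ∧
        (M.alpha ψ' φ' < M.alpha ψ φ ∨ M.asn₀ ψ' < M.asn₀ ψ →
          M.powerDeriv ψ' φ' < M.powerDeriv ψ φ) ∧
        (M.alpha ψ' φ' = M.alpha ψ φ → M.asn₀ ψ' = M.asn₀ ψ →
          M.powerDeriv ψ' φ' = M.powerDeriv ψ φ →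
            M.StoppingForm fdot b c ψ' ∧ M.DecisionForm fdot b ψ' φ') := by
  obtain ⟨γ₁, hγ, h1⟩ := h1.eventually_klDiv_le
  have hq2 := fun n => (SeqTest.Model.memLp_score h2 hγ h1 n).1
  have hσ := fun n => (SeqTest.Model.memLp_score h2 hγ h1 n).2
  have hq0 := SeqTest.Model.integral_score h2
  -- The parameter of the minorant: a = γ₁/c makes 4ac equal to the variance bound 4γ₁.
  have ha : 0 < γ₁ / c := div_pos hγ hc
  have hac : 4 * γ₁ ≤ 4 * (γ₁ / c) * c := by rw [mul_assoc, div_mul_cancel₀ _ hc.ne']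
  have hv := SeqTest.isOptimalValue ha hac hq2 hq0 hσ
  have hr := fun n z => SeqTest.Model.r_eq h2 (c := c) n z
    (SeqTest.tendsto_truncContValue ha hac hq2 hq0 hσ n z)
  have hforms := SeqTest.Model.forms_iff (b := b) h2 hv hr hq2
  have hdiff := SeqTest.Model.exists_hasDerivAt_power h2 h3 hγ h1
  refine ⟨fun ψ' φ' hψ' => ?_, fun ψ' φ' hψ' hα hT => ?_⟩
  · obtain ⟨d, -, hd⟩ := hdiff ψ' φ' (M.asn₀_lt_top hψ').1
    exact hd.differentiableAt
  obtain ⟨hm, hasn⟩ := M.asn₀_lt_top hfin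
  obtain ⟨hm', hasn'⟩ := M.asn₀_lt_top hψ'
  obtain ⟨d, hd, hder⟩ := hdiff ψ φ hm
  obtain ⟨d', hd', hder'⟩ := hdiff ψ' φ' hm'
  have hsum := hv.hasSum_lossGap (b := b) hq2 hq0 hσ ψ φ hm hd
  have hsum' := hv.hasSum_lossGap (b := b) hq2 hq0 hσ ψ' φ' hm' hd'
  have hzero := (hforms ψ φ).1 ⟨hψ, hφ⟩
  simp only [hzero] at hsum
  -- The given test has no loss, so its Lagrangian equals c + r₀(b); any competitor's is at least
  -- that (`hge`).
  have heq := hsum.unique hasSum_zero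
  have hnn' : ∀ n, 0 ≤ ∫ x, SeqTest.lossGap (SeqTest.Model.score h2) b c _ _ ψ' φ' n x
      ∂SeqTest.law (M.obsLaw M.θ₀) (n + 1) := fun n =>
    integral_nonneg fun x => hv.lossGap_nonneg ψ' φ' n x
  have hge := hsum'.nonneg hnn'
  have e1 : M.powerDeriv ψ φ = d := hder.deriv
  have e2 : M.powerDeriv ψ' φ' = d' := hder'.deriv
  simp only [SeqTest.Model.alpha, M.power_eq M.θ₀_mem] at hα ⊢
  have hT0 : 0 ≤ ∑' n : ℕ, ((n + 1 : ℕ) : ℝ) * SeqTest.stopMass (M.obsLaw M.θ₀) ψ (n + 1) :=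
    tsum_nonneg fun n => mul_nonneg (Nat.cast_nonneg _) (SeqTest.stopMass_nonneg _ ψ n)
  have hT0' : 0 ≤ ∑' n : ℕ, ((n + 1 : ℕ) : ℝ) * SeqTest.stopMass (M.obsLaw M.θ₀) ψ' (n + 1) :=
    tsum_nonneg fun n => mul_nonneg (Nat.cast_nonneg _) (SeqTest.stopMass_nonneg _ ψ' n)
  rw [e1, e2]
  rw [hasn, hasn'] at hT ⊢
  rw [ENNReal.ofReal_le_ofReal_iff hT0] at hT
  have hcT := mul_le_mul_of_nonneg_left hT hc.le
  have hbα := mul_le_mul_of_nonneg_left hα hb.le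
  refine ⟨by linarith, ?_, fun hα' hT' hd'' => (hforms ψ' φ').2 ?_⟩
  · rintro (h | h)
    · have := mul_lt_mul_of_pos_left h hb
      linarith
    · have := mul_lt_mul_of_pos_left ((ENNReal.ofReal_lt_ofReal_iff_of_nonneg hT0').1 h) hc
      linarith
  -- Equality in all three quantities gives equal Lagrangians, so the nonnegative losses of the
  -- competitor sum to zero.
  · rw [ENNReal.ofReal_eq_ofReal_iff hT0' hT0] at hT'
    rw [hα', hT', hd'', heq] at hsum'
    exact fun n => congrFun ((hasSum_zero_iff_of_nonneg hnn').1 hsum') n
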